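/- Let $n\ge 1$, let $\Omega\subset\mathbb R^{n+1}$ be a convex body (nonempty, compact, convex) and, for $z_0\in\Omega$, let $u_{z_0}(x)=\max_{z\in\Omega}\langle x,z-z_0\rangle$, $x\in\mathbb S^n$, be its support function with respect to $z_0$. Write $u=u_0$ for the support function with respect to the origin, and $V$ for Lebesgue volume. Assume that $u$ is a soliton of the Gauss curvature flow: $u$ is smooth on $\mathbb S^n$, the tensor $A_u=\bar g^{ik}(\bar\nabla_k\bar\nabla_j u+u\,\bar g_{kj})$ (with $\bar g$ the round metric of $\mathbb S^n$ and $\bar\nabla$ its Levi-Civita connection) is positive definite everywhere, and $u=K$ on $\mathbb S^n$, where $K(x)=1/\det A_u(x)$ is the Gauss curvature of $\partial\Omega$ at the point with outer unit normal $x$. Assume also that $V(\Omega)=V(B(1))$, where $B(1)$ is the closed unit ball centred at the origin. Then: (i) the origin is the entropy point of $\Omega$, i.e. it is the unique point $z_e\in\Omega$ with $$\frac1{\omega_n}\int_{\mathbb S^n}\log u_{z_e}\,d\theta=\mathcal E(\Omega):=\sup\Big\{\frac1{\omega_n}\int_{\mathbb S^n}\log u_{z_0}\,d\theta \;:\; z_0\in\Omega,\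 u_{z_0}>0\text{ on }\mathbb S^n\Big\},$$ where $d\theta$ is the surface measure of $\mathbb S^n$ and $\omega_n$ its total mass; (ii) the polar dual $\Omega^*_0=\{y : \langle y,z\rangle\le 1\ \text{for all } z\in\Omega\}$ satisfies $V(\Omega^*_0)\ge V(B(1))$. In particular, if the origin is the Santaló point of $\Omega$, that is, $0\in\Omega$ and $V(\Omega^*_0)\le V(\Omega^*_{z_0})$ for every $z_0\in\Omega$, where $\Omega^*_{z_0}=\{y+z_0 : \langle y,z-z_0\rangle\le1\ \text{for all } z\in\Omega\}$, then $\Omega=B(1)$. -/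

import Mathlib

open MeasureTheory Metric Set
open scoped Manifold ContDiff RealInnerProductSpace

noncomputable section

/-- The Euclidean space `ℝ^(n+1)`. -/
abbrev Amb (n : ℕ) : Type := EuclideanSpace ℝ (Fin (n + 1))

/-- The unit sphere `S^n` in `ℝ^(n+1)`. -/
abbrev Sph (n : ℕ) : Type := sphere (0 : Amb n) 1

/-- The dimension fact through which Mathlib equips `S^n` with its smooth structure. -/
instance factFinrankAmb (n : ℕ) : Fact (Module.finrank ℝ (Amb n) = n + 1) :=
  ⟨by simp⟩

/-- The surface measure `dθ` of `S^n` (of total mass `ω_n = (n + 1) V(B(1))`). -/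
def sphMeasure (n : ℕ) : Measure (Sph n) := (volume : Measure (Amb n)).toSphere

/-- The tangent space `T_x S^n`, realised as the orthogonal complement of `x` in `ℝ^(n+1)`. -/
abbrev sphTangent {n : ℕ} (x : Sph n) : Submodule ℝ (Amb n) :=
  (ℝ ∙ (x : Amb n))ᗮ

/-- The radial projection of a non-zero vector to `S^n`. -/
def sphNormalize {n : ℕ} (y : Amb n) (hy : y ≠ 0) : Sph n :=
  ⟨‖y‖⁻¹ • y, by simp [norm_smul, norm_ne_zero_iff.mpr hy]⟩

open Classical in
/-- The extension of a function on `S^n` to `ℝ^(n+1) \ {0}` that is constant on rays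
(with value `0` at the origin, where it is never used). -/
def radialExt {n : ℕ} (u : Sph n → ℝ) (y : Amb n) : ℝ :=
  if hy : y ≠ 0 then u (sphNormalize y hy) else 0

/-- The gradient field of `u : S^n → ℝ`. As the extension of `u` is constant on rays, its Euclidean
gradient at a point `x` of `S^n` is tangent to `S^n` and equals the intrinsic gradient of `u`
at `x`; at the other points it is a smooth extension of the intrinsic gradient field. -/
def sphGrad {n : ℕ} (u : Sph n → ℝ) (y : Amb n) : Amb n :=
  gradient (radialExt u) y

/-- The covariant Hessian of `u : S^n → ℝ` at `x` for the round metric `g`, with one index raised,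
`g^{ik} ∇_k ∇_j u`: the endomorphism `v ↦ ∇_v (grad u)` of `T_x S^n`. The Levi-Civita connection of
`S^n ⊆ ℝ^(n+1)` is the Euclidean derivative followed by the orthogonal projection to `T_x S^n`. -/
def sphHess {n : ℕ} (u : Sph n → ℝ) (x : Sph n) : sphTangent x →ₗ[ℝ] sphTangent x :=
  ((sphTangent x).orthogonalProjectionOnto ∘L
    fderiv ℝ (sphGrad u) (x : Amb n) ∘L (sphTangent x).subtypeL).toLinearMap

/-- The endomorphism `A_u = g^{ik} (∇_k ∇_j u + u g_{kj})` of `T_x S^n`. If `u` is the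
support function of a convex body with smooth strictly convex boundary `M`, this is the inverse of
the Weingarten map of `M` at the point with outer unit normal `x`. -/
def inverseWeingarten {n : ℕ} (u : Sph n → ℝ) (x : Sph n) : sphTangent x →ₗ[ℝ] sphTangent x :=
  sphHess u x + u x • LinearMap.id

/-- The Gauss curvature, in terms of the support function `u`, at the boundary point with outer
unit normal `x`: the determinant of the Weingarten map. -/
def gaussCurvature {n : ℕ} (u : Sph n → ℝ) (x : Sph n) : ℝ :=
  (LinearMap.det (inverseWeingarten u x))⁻¹

/-- `u` is a soliton: a smooth function on `S^n` with `A_u > 0` that satisfies `u = K`,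
that is, `u det (A_u) = 1`. -/
structure IsSoliton {n : ℕ} (u : Sph n → ℝ) : Prop where
  smooth : ContMDiff (𝓡 n) 𝓘(ℝ, ℝ) ∞ u
  posDef : ∀ (x : Sph n) (v : sphTangent x), v ≠ 0 → 0 < ⟪inverseWeingarten u x v, v⟫
  eq_gaussCurvature : ∀ x : Sph n, u x = gaussCurvature u x

/-- The support function `u_{z₀}(x) = max_{z ∈ Ω} ⟨x, z - z₀⟩` of `Ω` with respect to `z₀`. -/
def supportFn {n : ℕ} (Ω : ConvexBody (Amb n)) (z₀ : Amb n) (x : Sph n) : ℝ :=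
  sSup ((fun z : Amb n => ⟪(x : Amb n), z - z₀⟫) '' (Ω : Set (Amb n)))

/-- The mean value `(1 / ω_n) ∫_{S^n} log u_{z₀} dθ`. -/
def meanLogSupport {n : ℕ} (Ω : ConvexBody (Amb n)) (z₀ : Amb n) : ℝ :=
  ⨍ x, Real.log (supportFn Ω z₀ x) ∂(sphMeasure n)

/-- The values whose supremum is the entropy `ℰ(Ω)`: the mean values of `log u_{z₀}`
over all `z₀ ∈ Ω` for which the support function `u_{z₀}` is positive. -/
def entropyValues {n : ℕ} (Ω : ConvexBody (Amb n)) : Set ℝ :=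
  {s | ∃ z₀ ∈ Ω, (∀ x : Sph n, 0 < supportFn Ω z₀ x) ∧ s = meanLogSupport Ω z₀}

/-- `z` is an entropy point of `Ω`: `z ∈ Ω` and `ℰ(Ω) = (1 / ω_n) ∫_{S^n} log u_z dθ`. The second
and third clauses say that the integral is not `-∞`, so that it is the integral in Lean's sense. -/
structure IsEntropyPoint {n : ℕ} (Ω : ConvexBody (Amb n)) (z : Amb n) : Prop where
  mem : z ∈ Ω
  ae_pos : ∀ᵐ x ∂(sphMeasure n), 0 < supportFn Ω z x
  integrable : Integrable (fun x => Real.log (supportFn Ω z x)) (sphMeasure n)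
  isLUB : IsLUB (entropyValues Ω) (meanLogSupport Ω z)

/-- The polar dual `Ω*_{z₀} = {y + z₀ | max_{z ∈ Ω} ⟨y, z - z₀⟩ ≤ 1}` of `Ω` with respect
to `z₀`. -/
def polarBody {n : ℕ} (Ω : ConvexBody (Amb n)) (z₀ : Amb n) : Set (Amb n) :=
  (fun y => y + z₀) '' {y | ∀ z ∈ Ω, ⟪y, z - z₀⟫ ≤ 1}

/-- `z` is a Santaló point of `Ω`: a point of `Ω` with respect to which the polar dual has
the least volume. -/
def IsSantaloPoint {n : ℕ} (Ω : ConvexBody (Amb n)) (z : Amb n) : Prop :=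
  z ∈ Ω ∧ ∀ z₀ ∈ Ω, volume (polarBody Ω z) ≤ volume (polarBody Ω z₀)

end

/-! The soliton is shown to be the unit ball (`eq_closedBall_of_isSoliton`); every claim then
becomes a statement about the ball.

Let X(x) = `suppPt Ω x` be the boundary point with outer normal x, that is, the gradient of the
1-homogeneous support function `suppFn Ω`, and let ω be the mass of dθ. The equation u det A_u = 1
says that the surface area measure of Ω has density 1/u with respect to dθ, so the cone-volume
measure is uniform: rx ↦ rX(x) carries Lebesgue measure on the unit ball to Lebesgue measure on Ω
(`setLIntegral_eq_setLIntegral_ball`).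

Brunn–Minkowski (from Prékopa–Leindler) and the first variation of volume give Minkowski's first
inequality in the form V(L)/V(Ω) ≤ (ω⁻¹ ∫ h/u dθ)^(n+1), where h ≥ 0 bounds the support function of
L from above (`le_integral_pow`). It is applied to the projective images of Ω under z ↦ z/(1 -
ε⟨e,z⟩). Their volume ratio is exactly ω⁻¹ ∫ (1 - ε⟨e,X⟩)^(-(n+1)) dθ, and comparing the terms of
order ε² yields a local Brunn–Minkowski inequality (`integral_inner_suppPt_sq_le`): n ∫⟨X,e⟩² ≤ ∫
u⟨DX e,e⟩ + n (∫⟨X,e⟩)²/ω.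

The divergence theorem on the sphere gives ∫⟨X,e⟩² + ∫ u⟨DX e,e⟩ = (n+1) ∫⟨x,e⟩ u⟨X,e⟩. Eliminating
DX and summing over an orthonormal basis, one gets ∫|X|² ≤ ∫u² + nω|a|²/(n+1), with a the mean of X.
This is equivalent to the vanishing of the L² norm of the tangential part of X - a
(`exists_suppPt_sub_eq`). Hence u(x) = ⟨a,x⟩ + c and Ω is a ball of centre a; the volume gives c = 1
and the soliton equation gives a = 0.

For the unit ball u_z(x) = 1 - ⟨x,z⟩, so log t ≤ t - 1, with equality only at t = 1, identifies the
entropy point, and the polar body contains the ball. -/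

/-! ### Prékopa–Leindler and Brunn–Minkowski. -/

open scoped ENNReal Pointwise in
/-- The one-dimensional Brunn–Minkowski inequality for compact sets. -/
lemma volume_add_le_of_isCompact {K L C : Set ℝ} (hK : IsCompact K) (hL : IsCompact L)
    (hK0 : K.Nonempty) (hL0 : L.Nonempty) (h : ∀ a ∈ K, ∀ b ∈ L, a + b ∈ C) :
    volume K + volume L ≤ volume C := by
  -- With M = max K and m = min L, the translates m + K and M + L both lie in K + L and meet only at
  -- M + m.
  obtain ⟨M, hMK, hM⟩ := hK.exists_isGreatest hK0
  obtain ⟨m, hmL, hm⟩ := hL.exists_isLeast hL0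
  have h1 : volume ((m + ·) '' K) = volume K := by simp
  have h2 : volume ((M + ·) '' L) = volume L := by simp
  have hd : AEDisjoint volume ((m + ·) '' K) ((M + ·) '' L) := by
    refine measure_mono_null (t := {M + m}) ?_ (by simp)
    rintro _ ⟨⟨a, ha, rfl⟩, ⟨b, hb, hab⟩⟩
    have := hM ha
    have := hm hb
    simp only [mem_singleton_iff]
    simp only at hab
    linarith
  rw [← h1, ← h2, ← measure_union₀ (hL.image (by fun_prop)).measurableSet.nullMeasurableSet hd]
  refine measure_mono ?_
  rintro _ (⟨a, ha, rfl⟩ | ⟨b, hb, rfl⟩)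
  · simpa [add_comm] using h a ha m hmL
  · exact h M hMK b hb

open scoped ENNReal Pointwise in
/-- The one-dimensional Brunn–Minkowski inequality. -/
lemma volume_add_le_of_add_mem {A B C : Set ℝ} (hA : MeasurableSet A) (hB : MeasurableSet B)
    (hA0 : A.Nonempty) (hB0 : B.Nonempty) (h : ∀ a ∈ A, ∀ b ∈ B, a + b ∈ C) :
    volume A + volume B ≤ volume C := by
  obtain ⟨a, ha⟩ := hA0
  obtain ⟨b, hb⟩ := hB0
  rw [hA.measure_eq_iSup_isCompact, hB.measure_eq_iSup_isCompact]
  simp only [iSup_and']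
  refine ENNReal.biSup_add_biSup_le' ⟨{a}, by simpa using ha, isCompact_singleton⟩
    ⟨{b}, by simpa using hb, isCompact_singleton⟩ ?_
  rintro K ⟨hKA, hK⟩ L ⟨hLB, hL⟩
  -- Inserting a and b keeps the compact approximants non-empty.
  calc volume K + volume L ≤ volume (insert a K) + volume (insert b L) := by
        gcongr <;> exact subset_insert _ _
    _ ≤ volume C := by
        refine volume_add_le_of_isCompact (hK.insert a) (hL.insert b) ⟨a, by simp⟩ ⟨b, by simp⟩ ?_
        intro x hx y hy
        exact h x (insert_subset ha hKA hx) y (insert_subset hb hLB hy)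

open scoped ENNReal Pointwise in
/-- The weighted one-dimensional Brunn–Minkowski inequality. -/
lemma volume_weighted_add_le {s t : ℝ} (hs : 0 < s) (ht : 0 < t) {A B C : Set ℝ}
    (hA : MeasurableSet A) (hB : MeasurableSet B) (hA0 : A.Nonempty) (hB0 : B.Nonempty)
    (h : ∀ a ∈ A, ∀ b ∈ B, s * a + t * b ∈ C) :
    ENNReal.ofReal s * volume A + ENNReal.ofReal t * volume B ≤ volume C := by
  have key := volume_add_le_of_add_mem (C := C) (hA.const_smul₀ s) (hB.const_smul₀ t)
    hA0.smul_set hB0.smul_set (by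
      rintro _ ⟨a, ha, rfl⟩ _ ⟨b, hb, rfl⟩
      exact h a ha b hb)
  simpa [Measure.addHaar_smul, abs_of_pos hs, abs_of_pos ht] using key

open scoped ENNReal in
/-- Weighted AM-GM in `ℝ≥0∞`. -/
lemma ENNReal.rpow_mul_rpow_le {s t : ℝ} (hs : 0 < s) (ht : 0 < t) (hst : s + t = 1)
    (a b : ℝ≥0∞) : a ^ s * b ^ t ≤ ENNReal.ofReal s * a + ENNReal.ofReal t * b := by
  have hpq : (s⁻¹).HolderConjugate t⁻¹ := by
    rw [Real.holderConjugate_iff]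
    refine ⟨?_, by simpa using hst⟩
    exact (one_lt_inv₀ hs).2 (by linarith)
  have := ENNReal.young_inequality (a ^ s) (b ^ t) hpq
  rw [← ENNReal.rpow_mul, ← ENNReal.rpow_mul, mul_inv_cancel₀ hs.ne', mul_inv_cancel₀ ht.ne',
    ENNReal.rpow_one, ENNReal.rpow_one, ENNReal.ofReal_inv_of_pos hs, ENNReal.ofReal_inv_of_pos ht,
    div_eq_mul_inv, div_eq_mul_inv, inv_inv, inv_inv] at this
  rwa [mul_comm _ a, mul_comm _ b]

open scoped ENNReal in
/-- The one-dimensional Prékopa–Leindler inequality for functions with supremum `1`. -/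
lemma prekopaLeindler_real_of_iSup_eq_one {s t : ℝ} (hs : 0 < s) (ht : 0 < t) (hst : s + t = 1)
    {f g h : ℝ → ℝ≥0∞} (hf : Measurable f) (hg : Measurable g) (hh : Measurable h)
    (hf1 : ⨆ x, f x = 1) (hg1 : ⨆ x, g x = 1)
    (hfgh : ∀ x y, f x ^ s * g y ^ t ≤ h (s * x + t * y)) :
    (∫⁻ x, f x) ^ s * (∫⁻ x, g x) ^ t ≤ ∫⁻ x, h x := by
  have layer : ∀ φ : ℝ → ℝ≥0∞, Measurable φ → (∀ x, φ x ≤ 1) →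
      ∫⁻ x, φ x = ∫⁻ l in Ioo (0 : ℝ) 1, volume {x | ENNReal.ofReal l < φ x} := by
    intro φ hφ hφ1
    have hfin : ∀ x, φ x ≠ ⊤ := fun x => ((hφ1 x).trans_lt ENNReal.one_lt_top).ne
    calc ∫⁻ x, φ x = ∫⁻ x, ENNReal.ofReal (φ x).toReal := by
          simp_rw [ENNReal.ofReal_toReal (hfin _)]
      _ = ∫⁻ l in Ioi (0 : ℝ), volume {x | l < (φ x).toReal} :=
          lintegral_eq_lintegral_meas_lt _ (.of_forall fun x => ENNReal.toReal_nonneg)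
            hφ.ennreal_toReal.aemeasurable
      _ = ∫⁻ l in Ioo (0 : ℝ) 1, volume {x | l < (φ x).toReal} := by
          rw [← Ioo_union_Ici_eq_Ioi (zero_lt_one' ℝ), lintegral_union measurableSet_Ici
            (by rw [disjoint_left]; intro x hx hx'; exact absurd hx.2 (not_lt.2 hx'))]
          rw [setLIntegral_congr_fun (g := fun _ => 0) measurableSet_Ici]
          · simp
          · intro l hl
            have : {x | l < (φ x).toReal} = ∅ := by
              ext x
              simp only [mem_ofPred_eq, mem_empty_iff_false, iff_false, not_lt]
              refine le_trans ?_ (mem_Ici.1 hl)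
              simpa using ENNReal.toReal_mono ENNReal.one_ne_top (hφ1 x)
            simp [this]
      _ = _ := by
          refine setLIntegral_congr_fun measurableSet_Ioo fun l hl => ?_
          congr 1
          ext x
          exact (ENNReal.ofReal_lt_iff_lt_toReal hl.1.le (hfin x)).symm
  have hfle : ∀ x, f x ≤ 1 := fun x => hf1 ▸ le_iSup f x
  have hgle : ∀ x, g x ≤ 1 := fun x => hg1 ▸ le_iSup g x
  -- AM-GM reduces the claim to s∫f + t∫g ≤ ∫ min(h, 1), which is Brunn–Minkowski on superlevel
  -- sets, level by level. The common supremum 1 makes the sets of f and g non-empty at the same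
  -- levels l < 1.
  refine (ENNReal.rpow_mul_rpow_le hs ht hst _ _).trans ?_
  refine le_trans ?_ (lintegral_mono (fun x => min_le_left (h x) 1))
  rw [layer f hf hfle, layer g hg hgle,
    layer (fun x => min (h x) 1) (hh.min measurable_const) (fun x => min_le_right _ _)]
  rw [← lintegral_const_mul' _ _ ENNReal.ofReal_ne_top,
    ← lintegral_const_mul' _ _ ENNReal.ofReal_ne_top]
  refine (le_lintegral_add _ _).trans ?_
  refine setLIntegral_mono' measurableSet_Ioo fun l hl => ?_
  have hl1 : ENNReal.ofReal l < 1 := by simpa using hl.2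
  refine volume_weighted_add_le hs ht (measurableSet_lt measurable_const hf)
    (measurableSet_lt measurable_const hg) ?_ ?_ ?_
  · obtain ⟨x, hx⟩ := lt_iSup_iff.1 (hf1.symm ▸ hl1)
    exact ⟨x, hx⟩
  · obtain ⟨x, hx⟩ := lt_iSup_iff.1 (hg1.symm ▸ hl1)
    exact ⟨x, hx⟩
  · intro x hx y hy
    have h1 : ENNReal.ofReal l = ENNReal.ofReal l ^ s * ENNReal.ofReal l ^ t := by
      rw [← ENNReal.rpow_add_of_nonneg _ _ hs.le ht.le, hst, ENNReal.rpow_one]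
    refine lt_min (lt_of_lt_of_le ?_ (hfgh x y)) hl1
    rw [h1]
    exact ENNReal.mul_lt_mul (ENNReal.rpow_lt_rpow hx hs) (ENNReal.rpow_lt_rpow hy ht)

open scoped ENNReal in
/-- The one-dimensional Prékopa–Leindler inequality for bounded functions. -/
lemma prekopaLeindler_real_of_le {s t : ℝ} (hs : 0 < s) (ht : 0 < t) (hst : s + t = 1)
    {f g h : ℝ → ℝ≥0∞} (hf : Measurable f) (hg : Measurable g) (hh : Measurable h)
    {k : ℝ≥0∞} (hk : k ≠ ⊤) (hfk : ∀ x, f x ≤ k) (hgk : ∀ x, g x ≤ k)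
    (hfgh : ∀ x y, f x ^ s * g y ^ t ≤ h (s * x + t * y)) :
    (∫⁻ x, f x) ^ s * (∫⁻ x, g x) ^ t ≤ ∫⁻ x, h x := by
  set F := ⨆ x, f x with hF
  set G := ⨆ x, g x with hG
  have hFt : F ≠ ⊤ := ((iSup_le hfk).trans_lt hk.lt_top).ne
  have hGt : G ≠ ⊤ := ((iSup_le hgk).trans_lt hk.lt_top).ne
  by_cases hF0 : F = 0
  · have : ∀ x, f x = 0 := by simpa [hF] using hF0
    simp [this, hs]
  by_cases hG0 : G = 0
  · have : ∀ x, g x = 0 := by simpa [hG] using hG0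
    simp [this, ht]
  -- Dividing f, g, h by F, G, c preserves the hypothesis and makes both suprema 1.
  set c := F ^ s * G ^ t
  have hc0 : c ≠ 0 := mul_ne_zero (by simp [hF0, hFt]) (by simp [hG0, hGt])
  have hct : c ≠ ⊤ := ENNReal.mul_ne_top (ENNReal.rpow_ne_top_of_nonneg hs.le hFt)
    (ENNReal.rpow_ne_top_of_nonneg ht.le hGt)
  have hcinv : c⁻¹ = F⁻¹ ^ s * G⁻¹ ^ t := by
    rw [ENNReal.mul_inv (by simp [hF0, hFt]) (by simp [hG0, hGt]), ENNReal.inv_rpow,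
      ENNReal.inv_rpow]
  have key := prekopaLeindler_real_of_iSup_eq_one hs ht hst (f := fun x => F⁻¹ * f x)
    (g := fun x => G⁻¹ * g x) (h := fun x => c⁻¹ * h x) (hf.const_mul _) (hg.const_mul _)
    (hh.const_mul _) (by rw [← ENNReal.mul_iSup, ENNReal.inv_mul_cancel hF0 hFt])
    (by rw [← ENNReal.mul_iSup, ENNReal.inv_mul_cancel hG0 hGt]) (by
      intro x y
      rw [ENNReal.mul_rpow_of_nonneg _ _ hs.le, ENNReal.mul_rpow_of_nonneg _ _ ht.le,
        mul_mul_mul_comm, ← hcinv]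
      gcongr
      exact hfgh x y)
  rw [lintegral_const_mul _ hf, lintegral_const_mul _ hg, lintegral_const_mul _ hh,
    ENNReal.mul_rpow_of_nonneg _ _ hs.le, ENNReal.mul_rpow_of_nonneg _ _ ht.le,
    mul_mul_mul_comm, ← hcinv] at key
  exact (ENNReal.mul_le_mul_iff_right (by simpa using hct) (by simpa using hc0)).1 key

open scoped ENNReal in
/-- The one-dimensional Prékopa–Leindler inequality. -/
lemma prekopaLeindler_real {s t : ℝ} (hs : 0 < s) (ht : 0 < t) (hst : s + t = 1)
    {f g h : ℝ → ℝ≥0∞} (hf : Measurable f) (hg : Measurable g) (hh : Measurable h)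
    (hfgh : ∀ x y, f x ^ s * g y ^ t ≤ h (s * x + t * y)) :
    (∫⁻ x, f x) ^ s * (∫⁻ x, g x) ^ t ≤ ∫⁻ x, h x := by
  have trunc : ∀ φ : ℝ → ℝ≥0∞, Measurable φ →
      ∫⁻ x, φ x = ⨆ k : ℕ, ∫⁻ x, min (φ x) k := by
    intro φ hφ
    rw [← lintegral_iSup (fun k => hφ.min measurable_const)
      (fun i j hij x => min_le_min le_rfl (by exact_mod_cast hij))]
    refine lintegral_congr fun x => le_antisymm ?_ (iSup_le fun k => min_le_left _ _)
    rcases eq_or_ne (φ x) ∞ with hx | hx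
    · simp [hx, ENNReal.iSup_natCast]
    · obtain ⟨k, hk⟩ := ENNReal.exists_nat_gt hx
      exact le_iSup_of_le k (by simp [hk.le])
  have mono : ∀ (φ : ℝ → ℝ≥0∞) {i j : ℕ}, i ≤ j → ∫⁻ x, min (φ x) i ≤ ∫⁻ x, min (φ x) j :=
    fun φ i j hij => lintegral_mono fun x => min_le_min le_rfl (by exact_mod_cast hij)
  rw [trunc f hf, trunc g hg, (ENNReal.monotone_rpow_of_nonneg hs.le).map_iSup_of_continuousAt
    ENNReal.continuous_rpow_const.continuousAt (by simp [hs]),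
    (ENNReal.monotone_rpow_of_nonneg ht.le).map_iSup_of_continuousAt
    ENNReal.continuous_rpow_const.continuousAt (by simp [ht])]
  simp only [ENNReal.iSup_mul, ENNReal.mul_iSup]
  refine iSup_le fun i => iSup_le fun j => ?_
  refine le_trans (mul_le_mul' (ENNReal.rpow_le_rpow (mono f (le_max_right i j)) hs.le)
    (ENNReal.rpow_le_rpow (mono g (le_max_left i j)) ht.le)) ?_
  refine prekopaLeindler_real_of_le hs ht hst (hf.min measurable_const) (hg.min measurable_const)
    hh (ENNReal.natCast_ne_top (max i j)) (fun x => min_le_right _ _) (fun x => min_le_right _ _) ?_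
  intro x y
  refine le_trans ?_ (hfgh x y)
  gcongr <;> exact min_le_left _ _

open scoped ENNReal in
/-- The Prékopa–Leindler inequality. -/
theorem prekopaLeindler {s t : ℝ} (hs : 0 < s) (ht : 0 < t) (hst : s + t = 1) (d : ℕ) :
    ∀ {f g h : (Fin d → ℝ) → ℝ≥0∞}, Measurable f → Measurable g → Measurable h →
    (∀ x y, f x ^ s * g y ^ t ≤ h (s • x + t • y)) →
    (∫⁻ x, f x) ^ s * (∫⁻ x, g x) ^ t ≤ ∫⁻ x, h x := by
  induction d with
  | zero =>
    intro f g h _ _ _ hfgh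
    have hv : (volume : Measure (Fin 0 → ℝ)) = Measure.dirac 0 := by
      rw [volume_pi, Measure.pi_of_empty _ 0]
    have := hfgh 0 0
    simpa [hv] using this
  | succ d ih =>
    intro f g h hf hg hh hfgh
    have slice : ∀ φ : (Fin (d + 1) → ℝ) → ℝ≥0∞, Measurable φ →
        ∫⁻ x, φ x = ∫⁻ a : ℝ, ∫⁻ y : Fin d → ℝ, φ (Fin.cons a y) := by
      intro φ hφ
      have hmp := (volume_preserving_piFinSuccAbove (fun _ : Fin (d + 1) => ℝ) 0).symm
      rw [← hmp.lintegral_comp hφ, Measure.volume_eq_prod, lintegral_prod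
        (fun z => φ ((MeasurableEquiv.piFinSuccAbove (fun _ : Fin (d + 1) => ℝ) 0).symm z))
        (hφ.comp hmp.measurable).aemeasurable]
      simp [MeasurableEquiv.piFinSuccAbove_symm_apply, Fin.insertNthEquiv]
    have meas2 : Measurable (fun p : ℝ × (Fin d → ℝ) => (Fin.cons p.1 p.2 : Fin (d + 1) → ℝ)) := by
      refine measurable_pi_iff.2 fun i => ?_
      refine Fin.cases ?_ (fun j => ?_) i
      · simpa using measurable_fst
      · simpa [Function.comp_def] using (measurable_pi_apply j).comp measurable_snd
    have meas : ∀ φ : (Fin (d + 1) → ℝ) → ℝ≥0∞, Measurable φ →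
        Measurable fun a : ℝ => ∫⁻ y : Fin d → ℝ, φ (Fin.cons a y) := by
      intro φ hφ
      exact (hφ.comp meas2).lintegral_prod_right'
    rw [slice f hf, slice g hg, slice h hh]
    -- The induction hypothesis on the slices over a and b is the one-dimensional hypothesis for the
    -- slice integrals.
    refine prekopaLeindler_real hs ht hst (meas f hf) (meas g hg) (meas h hh) fun a b => ?_
    have m1 : ∀ a : ℝ, Measurable fun y : Fin d → ℝ => (Fin.cons a y : Fin (d + 1) → ℝ) :=
      fun a => meas2.comp measurable_prodMk_left
    refine ih (hf.comp (m1 a)) (hg.comp (m1 b)) (hh.comp (m1 _)) fun x y => ?_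
    refine (hfgh _ _).trans (le_of_eq ?_)
    congr 1
    ext i
    refine Fin.cases ?_ (fun j => ?_) i <;> simp

open scoped Pointwise in
/-- The multiplicative Brunn–Minkowski inequality for compact sets of equal volume. -/
theorem volume_le_volume_weighted_add {n : ℕ} {s t : ℝ} (hs : 0 < s) (ht : 0 < t)
    (hst : s + t = 1) {K L : Set (Amb n)} (hK : IsCompact K) (hL : IsCompact L)
    (hKL : volume L = volume K) : volume K ≤ volume (s • K + t • L) := by
  classical
  set e : (Fin (n + 1) → ℝ) → Amb n := WithLp.toLp 2
  have he : MeasurePreserving e := PiLp.volume_preserving_toLp _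
  have hC : MeasurableSet (s • K + t • L) := ((hK.smul s).add (hL.smul t)).measurableSet
  have hm : ∀ {A : Set (Amb n)}, MeasurableSet A →
      Measurable (fun x => A.indicator (1 : Amb n → ENNReal) (e x)) := fun hA =>
    (measurable_one.indicator hA).comp he.measurable
  have key := prekopaLeindler hs ht hst (n + 1) (hm hK.measurableSet) (hm hL.measurableSet) (hm hC)
    (by
      intro x y
      by_cases hx : e x ∈ K
      · by_cases hy : e y ∈ L
        · have : e (s • x + t • y) ∈ s • K + t • L :=
            ⟨s • e x, ⟨_, hx, rfl⟩, t • e y, ⟨_, hy, rfl⟩, rfl⟩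
          simp [hx, hy, this]
        · simp [hy, ht]
      · simp [hx, hs])
  have hi : ∀ {A : Set (Amb n)}, MeasurableSet A →
      ∫⁻ x, A.indicator (1 : Amb n → ENNReal) (e x) = volume A := fun hA => by
    rw [he.lintegral_comp (measurable_one.indicator hA), lintegral_indicator_one hA]
  rw [hi hK.measurableSet, hi hL.measurableSet, hi hC, hKL,
    ← ENNReal.rpow_add_of_nonneg _ _ hs.le ht.le, hst, ENNReal.rpow_one] at key
  exact key

/-! ### Polar coordinates and the divergence theorem on the sphere. -/

lemma finrank_amb (n : ℕ) : Module.finrank ℝ (Amb n) = n + 1 := by simp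

instance isFiniteMeasure_sphMeasure (n : ℕ) : IsFiniteMeasure (sphMeasure n) :=
  inferInstanceAs (IsFiniteMeasure (Measure.toSphere _))

instance isOpenPosMeasure_sphMeasure (n : ℕ) : (sphMeasure n).IsOpenPosMeasure :=
  inferInstanceAs (Measure.IsOpenPosMeasure (Measure.toSphere _))

lemma lintegral_volumeIoiPow (n : ℕ) (f : ℝ → ENNReal) :
    ∫⁻ r : Ioi (0 : ℝ), f r ∂(Measure.volumeIoiPow n) =
      ∫⁻ r in Ioi (0 : ℝ), ENNReal.ofReal (r ^ n) * f r := by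
  rw [Measure.volumeIoiPow, lintegral_withDensity_eq_lintegral_mul_non_measurable₀]
  · exact lintegral_subtype_comap measurableSet_Ioi (fun r => ENNReal.ofReal (r ^ n) * f r)
  · exact (measurable_subtype_coe.pow_const _).ennreal_ofReal.aemeasurable
  · exact .of_forall fun _ => ENNReal.ofReal_lt_top

lemma integral_volumeIoiPow (n : ℕ) (f : ℝ → ℝ) :
    ∫ r : Ioi (0 : ℝ), f r ∂(Measure.volumeIoiPow n) = ∫ r in Ioi (0 : ℝ), r ^ n * f r := by
  simp only [Measure.volumeIoiPow, ENNReal.ofReal]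
  rw [integral_withDensity_eq_integral_smul,
    integral_subtype_comap measurableSet_Ioi fun a ↦ Real.toNNReal (a ^ n) • f a,
    setIntegral_congr_fun measurableSet_Ioi fun x hx ↦ ?_]
  · rw [NNReal.smul_def, Real.coe_toNNReal _ (pow_nonneg hx.out.le _), smul_eq_mul]
  · exact (measurable_subtype_coe.pow_const _).real_toNNReal

/-- Polar coordinates as a measure-preserving map. -/
lemma measurePreserving_polar (n : ℕ) :
    MeasurePreserving (fun p : Sph n × Ioi (0 : ℝ) => (p.2 : ℝ) • (p.1 : Amb n))
      ((sphMeasure n).prod (Measure.volumeIoiPow n)) volume := by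
  have h1 := (volume : Measure (Amb n)).measurePreserving_homeomorphUnitSphereProd
  rw [finrank_amb, Nat.add_sub_cancel] at h1
  have h2 := MeasurePreserving.symm (homeomorphUnitSphereProd (Amb n)).toMeasurableEquiv h1
  have h3 : MeasurePreserving (Subtype.val : ({0}ᶜ : Set (Amb n)) → Amb n)
      ((volume : Measure (Amb n)).comap (↑)) volume := by
    refine ⟨measurable_subtype_coe, ?_⟩
    rw [map_comap_subtype_coe (measurableSet_singleton _).compl, restrict_compl_singleton]
  exact h3.comp h2

/-- Integration in polar coordinates for the Lebesgue integral. -/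
lemma lintegral_polar {n : ℕ} {f : Amb n → ENNReal} (hf : Measurable f) :
    ∫⁻ y, f y = ∫⁻ x : Sph n, (∫⁻ r in Ioi (0 : ℝ),
      ENNReal.ofReal (r ^ n) * f (r • (x : Amb n))) ∂(sphMeasure n) := by
  rw [← (measurePreserving_polar n).lintegral_comp hf, lintegral_prod
    (fun p : Sph n × Ioi (0 : ℝ) => f ((p.2 : ℝ) • (p.1 : Amb n))) (hf.comp (measurePreserving_polar n).measurable).aemeasurable]
  refine lintegral_congr fun x => ?_
  exact lintegral_volumeIoiPow n (fun r => f (r • (x : Amb n)))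

/-- The map of polar coordinates is a measurable embedding. -/
lemma measurableEmbedding_polar (n : ℕ) :
    MeasurableEmbedding (fun p : Sph n × Ioi (0 : ℝ) => (p.2 : ℝ) • (p.1 : Amb n)) :=
  (MeasurableEmbedding.subtype_coe (measurableSet_singleton (0 : Amb n)).compl).comp
    (homeomorphUnitSphereProd (Amb n)).symm.measurableEmbedding

/-- Integration in polar coordinates for products of a radial and a spherical function. -/
lemma integral_polar_mul {n : ℕ} {f : Amb n → ℝ} {a : ℝ → ℝ} {g : Sph n → ℝ}
    (h : ∀ r > (0 : ℝ), ∀ x : Sph n, f (r • (x : Amb n)) = g x * a r) :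
    ∫ y, f y = (∫ x, g x ∂(sphMeasure n)) * ∫ r in Ioi (0 : ℝ), r ^ n * a r := by
  rw [← (measurePreserving_polar n).integral_comp (measurableEmbedding_polar n)]
  rw [← integral_volumeIoiPow, ← integral_prod_mul]
  refine integral_congr_ae (.of_forall fun p => ?_)
  exact h p.2 p.2.2 p.1

lemma sphMeasure_univ (n : ℕ) :
    sphMeasure n univ = (n + 1 : ℕ) * volume (closedBall (0 : Amb n) 1) := by
  rw [sphMeasure, Measure.toSphere_apply_univ, finrank_amb, Measure.addHaar_closedBall_eq_addHaar_ball]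

lemma sphMeasure_real_univ (n : ℕ) :
    (sphMeasure n).real univ = (n + 1) * volume.real (closedBall (0 : Amb n) 1) := by
  rw [measureReal_def, sphMeasure_univ, ENNReal.toReal_mul, measureReal_def, ENNReal.toReal_natCast]
  push_cast
  rfl

lemma sphMeasure_real_univ_pos (n : ℕ) : 0 < (sphMeasure n).real univ := by
  rw [sphMeasure_real_univ]
  have : 0 < volume.real (closedBall (0 : Amb n) 1) :=
    ENNReal.toReal_pos (measure_closedBall_pos _ _ one_pos).ne' measure_closedBall_lt_top.ne
  positivity

lemma Continuous.integrable_sph {n : ℕ} {f : Sph n → ℝ} (hf : Continuous f) :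
    Integrable f (sphMeasure n) := by
  have : CompactSpace (Sph n) := isCompact_iff_compactSpace.1 (isCompact_sphere _ _)
  exact hf.integrable_of_hasCompactSupport (HasCompactSupport.of_compactSpace f)

lemma norm_sph {n : ℕ} (x : Sph n) : ‖(x : Amb n)‖ = 1 := by simp

lemma sph_ne_zero {n : ℕ} (x : Sph n) : (x : Amb n) ≠ 0 := by
  rw [← norm_ne_zero_iff, norm_sph]; norm_num

lemma inner_self_sph {n : ℕ} (x : Sph n) : ⟪(x : Amb n), (x : Amb n)⟫ = 1 := by
  rw [real_inner_self_eq_norm_sq, norm_sph]; norm_num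

lemma fderiv_smul_of_homogeneous {E : Type*} [NormedAddCommGroup E] [NormedSpace ℝ E] {n : ℕ}
    {F : Amb n → E} (hF : ∀ r > (0 : ℝ), ∀ y, F (r • y) = r • F y) {r : ℝ} (hr : 0 < r) (y : Amb n) :
    fderiv ℝ F (r • y) = fderiv ℝ F y := by
  have h1 := fderiv_comp_smul (f := F) (x := y) r
  have h2 : (fun y => F (r • y)) = r • F := funext fun y => hF r hr y
  rw [h2, fderiv_const_smul_field] at h1
  exact (smul_right_injective _ hr.ne' h1).symm

/-- The divergence theorem on the sphere for the gradient of a `1`-homogeneous function. -/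
theorem integral_sph_fderiv {n : ℕ} {F : Amb n → ℝ} (hF : ContDiffOn ℝ 1 F {0}ᶜ)
    (hhom : ∀ r > (0 : ℝ), ∀ y, F (r • y) = r • F y) (e : Amb n) :
    ∫ x : Sph n, fderiv ℝ F x e ∂(sphMeasure n) =
      (n + 1) * ∫ x : Sph n, ⟪(x : Amb n), e⟫ * F x ∂(sphMeasure n) := by
  -- b(‖y‖²) vanishes unless 1 < ‖y‖² < 5, which cuts off infinity and the origin, where F need not
  -- be differentiable.
  let b : ContDiffBump (3 : ℝ) := ⟨1, 2, by norm_num, by norm_num⟩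
  have hbC : ContDiff ℝ 1 (b : ℝ → ℝ) := b.contDiff
  have hbd : ∀ t, HasDerivAt (b : ℝ → ℝ) (deriv b t) t := fun t =>
    (hbC.differentiable one_ne_zero t).hasDerivAt
  have hbd' : Continuous (deriv (b : ℝ → ℝ)) := hbC.continuous_deriv le_rfl
  have hb0 : ∀ t ≤ 1, b t = 0 := fun t ht => b.zero_of_le_dist (by
    rw [Real.dist_eq, abs_of_nonpos (by linarith)]; change 2 ≤ _; linarith)
  have hb5 : ∀ t, 5 ≤ t → b t = 0 := fun t ht => b.zero_of_le_dist (by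
    rw [Real.dist_eq, abs_of_nonneg (by linarith)]; change 2 ≤ _; linarith)
  have hd0 : ∀ t < 1, deriv b t = 0 := fun t ht => by
    have : (b : ℝ → ℝ) =ᶠ[nhds t] fun _ => 0 := by
      filter_upwards [Iio_mem_nhds ht] with s hs using hb0 s (le_of_lt hs)
    rw [this.deriv_eq, deriv_const]
  have hd5 : ∀ t, 5 < t → deriv b t = 0 := fun t ht => by
    have : (b : ℝ → ℝ) =ᶠ[nhds t] fun _ => 0 := by
      filter_upwards [Ioi_mem_nhds ht] with s hs using hb5 s (le_of_lt hs)
    rw [this.deriv_eq, deriv_const]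
  have hopen : IsOpen ({0}ᶜ : Set (Amb n)) := isOpen_compl_singleton
  have hFd : ∀ y ≠ 0, HasFDerivAt F (fderiv ℝ F y) y := fun y hy =>
    ((hF.contDiffAt (hopen.mem_nhds hy)).differentiableAt one_ne_zero).hasFDerivAt
  have hF'c : ContinuousOn (fun y => fderiv ℝ F y e) {0}ᶜ :=
    (hF.continuousOn_fderiv_of_isOpen hopen le_rfl).clm_apply continuousOn_const
  -- a cut-off function times a function continuous off the origin is continuous
  have cut : ∀ (c : ℝ → ℝ) (g : Amb n → ℝ), Continuous c → (∀ t < 1, c t = 0) →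
      (∀ t, 5 < t → c t = 0) → ContinuousOn g {0}ᶜ →
      Integrable (fun y : Amb n => c (‖y‖ ^ 2) * g y) := by
    intro c g hc hc1 hc5 hg
    refine Continuous.integrable_of_hasCompactSupport ?_ ?_
    · refine continuous_iff_continuousAt.2 fun y => ?_
      by_cases hy : y = 0
      · have : (fun y : Amb n => c (‖y‖ ^ 2) * g y) =ᶠ[nhds y] fun _ => 0 := by
          have : ∀ᶠ z : Amb n in nhds y, ‖z‖ ^ 2 < 1 :=
            (by fun_prop : Continuous fun z : Amb n => ‖z‖ ^ 2).continuousAt.eventually_lt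
              continuousAt_const (by simp [hy])
          filter_upwards [this] with z hz
          rw [hc1 _ hz, zero_mul]
        exact this.continuousAt
      · exact (hc.comp (by fun_prop : Continuous fun z : Amb n => ‖z‖ ^ 2)).continuousAt.mul
          (hg.continuousAt (hopen.mem_nhds hy))
    · refine HasCompactSupport.intro (isCompact_closedBall (0 : Amb n) 3) fun y hy => ?_
      rw [mem_closedBall_zero_iff, not_le] at hy
      rw [hc5 _ (by nlinarith), zero_mul]
  let D : Amb n → ℝ := fun y => b (‖y‖ ^ 2) * fderiv ℝ F y e +
    deriv b (‖y‖ ^ 2) * (2 * ⟪y, e⟫ * F y)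
  have hline : ∀ y, HasLineDerivAt ℝ (fun y => b (‖y‖ ^ 2) * F y) (D y) y e := by
    intro y
    by_cases hy : y = 0
    · have hev : (fun y : Amb n => b (‖y‖ ^ 2) * F y) =ᶠ[nhds y] fun _ => 0 := by
        have : ∀ᶠ z : Amb n in nhds y, ‖z‖ ^ 2 < 1 :=
          (by fun_prop : Continuous fun z : Amb n => ‖z‖ ^ 2).continuousAt.eventually_lt
            continuousAt_const (by simp [hy])
        filter_upwards [this] with z hz
        rw [hb0 _ hz.le, zero_mul]
      have hD : D y = 0 := by simp [D, hy, hb0 0, hd0 0]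
      rw [hD]
      have := ((hasFDerivAt_const (𝕜 := ℝ) (0 : ℝ) y).congr_of_eventuallyEq hev).hasLineDerivAt e
      simpa using this
    · have h1 : HasFDerivAt (fun y : Amb n => ‖y‖ ^ 2) ((2 : ℕ) • innerSL ℝ y : Amb n →L[ℝ] ℝ) y :=
        (hasStrictFDerivAt_norm_sq y).hasFDerivAt
      have h2 := ((hbd (‖y‖ ^ 2)).comp_hasFDerivAt y h1).mul (hFd y hy)
      have h3 := h2.hasLineDerivAt e
      have hD : D y = (((b : ℝ → ℝ) ∘ fun y : Amb n => ‖y‖ ^ 2) y • fderiv ℝ F y +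
          F y • deriv b (‖y‖ ^ 2) • ((2 : ℕ) • innerSL ℝ y : Amb n →L[ℝ] ℝ)) e := by
        simp [D]
        ring
      rw [hD]
      exact h3
  have hI1 := cut b _ hbC.continuous (fun t ht => hb0 t ht.le) (fun t ht => hb5 t ht.le) hF'c
  have hI2 := cut (deriv b) (fun y => 2 * ⟪y, e⟫ * F y) hbd' hd0 hd5
    ((by fun_prop : Continuous fun y : Amb n => 2 * ⟪y, e⟫).continuousOn.mul hF.continuousOn)
  have hI3 := cut b F hbC.continuous (fun t ht => hb0 t ht.le) (fun t ht => hb5 t ht.le)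
    hF.continuousOn
  -- Integration by parts against the constant 1: a compactly supported function has directional
  -- derivatives of integral zero.
  have hzero : ∫ y, D y = 0 := by
    have := integral_bilinear_hasLineDerivAt_right_eq_neg_left_of_integrable
      (f := fun _ : Amb n => (1 : ℝ)) (f' := fun _ => 0) (g := fun y => b (‖y‖ ^ 2) * F y)
      (g' := D) (v := e) (B := ContinuousLinearMap.mul ℝ ℝ) (μ := volume)
      (by simp) (by simp only [ContinuousLinearMap.mul_apply', one_mul]; exact hI1.add hI2) (by simpa using hI3)
      (fun x _ => by simpa using (hasFDerivAt_const (1 : ℝ) x).hasLineDerivAt e)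
      (fun x _ => hline x)
    simpa using this
  rw [integral_add hI1 hI2] at hzero
  have hr2 : ∀ r > (0 : ℝ), ∀ x : Sph n, ‖r • (x : Amb n)‖ ^ 2 = r ^ 2 := fun r hr x => by
    rw [norm_smul, norm_sph]; simp
  rw [integral_polar_mul (a := fun r => b (r ^ 2)) (g := fun x : Sph n => fderiv ℝ F x e)
      (fun r hr x => by rw [hr2 r hr, fderiv_smul_of_homogeneous hhom hr, mul_comm]),
    integral_polar_mul (a := fun r => deriv b (r ^ 2) * (2 * r ^ 2))
      (g := fun x : Sph n => ⟪(x : Amb n), e⟫ * F x)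
      (fun r hr x => by
        rw [hr2 r hr, hhom r hr, inner_smul_left, smul_eq_mul]; simp; ring)] at hzero
  have hC1 : ContDiff ℝ 1 fun r : ℝ => r ^ (n + 1) * b (r ^ 2) :=
    (contDiff_id.pow _).mul (hbC.comp (contDiff_id.pow 2))
  have hcs : ∀ (c : ℝ → ℝ), (∀ t, 5 < t → c t = 0) →
      HasCompactSupport fun r : ℝ => r ^ n * c (r ^ 2) := by
    intro c hc
    refine HasCompactSupport.intro (isCompact_closedBall (0 : ℝ) 3) fun y hy => ?_
    rw [mem_closedBall_zero_iff, not_le, Real.norm_eq_abs] at hy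
    rw [hc _ (by rw [← sq_abs]; nlinarith), mul_zero]
  have hJ1 : Integrable fun r : ℝ => r ^ n * b (r ^ 2) :=
    Continuous.integrable_of_hasCompactSupport
      ((continuous_pow n).mul (hbC.continuous.comp (continuous_pow 2)))
      (hcs b fun t ht => hb5 t ht.le)
  have hJ2 : Integrable fun r : ℝ => r ^ n * (deriv b (r ^ 2) * (2 * r ^ 2)) := by
    refine Continuous.integrable_of_hasCompactSupport (by fun_prop)
      (hcs (fun t => deriv b t * (2 * t)) fun t ht => by simp [hd5 t ht])
  -- Integrating the derivative of r^(n+1) b(r²) makes the second radial integral -(n+1) times the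
  -- first, so the radial factor cancels from the identity.
  have hrad : (∫ r in Ioi (0 : ℝ), r ^ n * (deriv b (r ^ 2) * (2 * r ^ 2))) =
      -(n + 1) * ∫ r in Ioi (0 : ℝ), r ^ n * b (r ^ 2) := by
    have h0 := HasCompactSupport.integral_Ioi_deriv_eq hC1
      (by
        refine HasCompactSupport.intro (isCompact_closedBall (0 : ℝ) 3) fun y hy => ?_
        rw [mem_closedBall_zero_iff, not_le, Real.norm_eq_abs] at hy
        rw [hb5 _ (by rw [← sq_abs]; nlinarith), mul_zero]) 0
    have hder : deriv (fun r : ℝ => r ^ (n + 1) * b (r ^ 2)) = fun r =>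
        (n + 1) * (r ^ n * b (r ^ 2)) + r ^ n * (deriv b (r ^ 2) * (2 * r ^ 2)) := by
      funext r
      have h1 := (hasDerivAt_pow (n + 1) r).mul ((hbd (r ^ 2)).comp r (hasDerivAt_pow 2 r))
      rw [show (fun r : ℝ => r ^ (n + 1) * b (r ^ 2)) =
        (fun r => r ^ (n + 1)) * ((b : ℝ → ℝ) ∘ fun r => r ^ 2) from rfl, h1.deriv]
      simp
      ring
    rw [hder, integral_add (hJ1.const_mul _).integrableOn hJ2.integrableOn,
      integral_const_mul] at h0
    simp at h0
    linarith
  have hpos : 0 < ∫ r in Ioi (0 : ℝ), r ^ n * b (r ^ 2) := by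
    rw [setIntegral_pos_iff_support_of_nonneg_ae]
    · refine lt_of_lt_of_le (b := volume (Ioo (3 / 2 : ℝ) 2)) (by simp; norm_num) ?_
      refine measure_mono fun r hr => ⟨?_, ?_⟩
      · have : 0 < b (r ^ 2) := b.pos_of_mem_ball (by
          rw [mem_ball, Real.dist_eq, abs_lt]
          change -2 < _ ∧ _ < 2
          constructor <;> nlinarith [hr.1, hr.2])
        have : 0 < r ^ n := pow_pos (by linarith [hr.1]) n
        rw [Function.mem_support]
        positivity
      · have := hr.1
        simp only [mem_Ioi]; linarith
    · filter_upwards [ae_restrict_mem measurableSet_Ioi] with r hr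
      have : 0 ≤ r ^ n := pow_nonneg (le_of_lt hr) n
      exact mul_nonneg this b.nonneg
    · exact hJ1.integrableOn
  rw [hrad] at hzero
  have : (∫ r in Ioi (0 : ℝ), r ^ n * b (r ^ 2)) * ((∫ x : Sph n, fderiv ℝ F x e ∂(sphMeasure n)) -
      (n + 1) * ∫ x : Sph n, ⟪(x : Amb n), e⟫ * F x ∂(sphMeasure n)) = 0 := by
    linear_combination hzero
  rcases mul_eq_zero.1 this with h | h
  · exact absurd h hpos.ne'
  · linarith

/-- The first moments of the sphere. -/
lemma integral_sph_inner_mul_inner {n : ℕ} (v w : Amb n) :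
    (n + 1) * ∫ x : Sph n, ⟪(x : Amb n), v⟫ * ⟪(x : Amb n), w⟫ ∂(sphMeasure n) =
      (sphMeasure n).real univ * ⟪v, w⟫ := by
  have h := integral_sph_fderiv (F := fun y : Amb n => ⟪y, w⟫)
    (contDiff_id.inner ℝ contDiff_const).contDiffOn
    (fun r _ y => by simp [inner_smul_left]) v
  rw [← h]
  have : ∀ x : Sph n, fderiv ℝ (fun y : Amb n => ⟪y, w⟫) x v = ⟪v, w⟫ := fun x => by
    have : HasFDerivAt (fun y : Amb n => ⟪y, w⟫) (innerSL ℝ w) (x : Amb n) := by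
      have := (innerSL ℝ w).hasFDerivAt (x := (x : Amb n))
      refine this.congr_of_eventuallyEq (.of_forall fun y => ?_)
      simp [real_inner_comm]
    rw [this.fderiv, innerSL_apply_apply, real_inner_comm]
  simp [this]

lemma HasFDerivAt_norm {n : ℕ} {y : Amb n} (hy : y ≠ 0) :
    HasFDerivAt (fun y : Amb n => ‖y‖) (‖y‖⁻¹ • innerSL ℝ y) y := by
  have hy' : ‖y‖ ≠ 0 := norm_ne_zero_iff.2 hy
  have h1 : HasFDerivAt (fun y : Amb n => ‖y‖ ^ 2) ((2 : ℕ) • innerSL ℝ y : Amb n →L[ℝ] ℝ) y :=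
    (hasStrictFDerivAt_norm_sq y).hasFDerivAt
  have h2 := h1.sqrt (by positivity)
  simp only [Real.sqrt_sq (norm_nonneg _)] at h2
  have hc : ‖y‖⁻¹ • innerSL ℝ y =
      (1 / (2 * ‖y‖)) • ((2 : ℕ) • innerSL ℝ y : Amb n →L[ℝ] ℝ) := by
    ext v
    simp
    field_simp
  rw [hc]
  exact h2

/-! ### Determinants -/

/-- The determinant of a block-triangular endomorphism that is the sum of an endomorphism of the
hyperplane `x^⊥` and a rank-one map. -/
lemma det_eq_inner_mul_det {n : ℕ} (x : Sph n) (T : Amb n →ₗ[ℝ] Amb n) (p : Amb n)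
    (A : sphTangent x →ₗ[ℝ] sphTangent x) (hA : ∀ v : sphTangent x, T v = A v)
    (hT : ∀ v, ⟪(x : Amb n), T v⟫ = ⟪(x : Amb n), v⟫ * ⟪(x : Amb n), p⟫) :
    LinearMap.det T = ⟪(x : Amb n), p⟫ * LinearMap.det A := by
  have hW : sphTangent x ≤ (sphTangent x).comap T := fun v hv => by
    rw [Submodule.mem_comap, Submodule.mem_orthogonal_singleton_iff_inner_right, hT,
      Submodule.mem_orthogonal_singleton_iff_inner_right.1 hv, zero_mul]
  -- T preserves x^⊥ and acts on the one-dimensional quotient as multiplication by ⟪x, p⟫.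
  rw [LinearMap.det_eq_det_mul_det (sphTangent x) T hW, mul_comm]
  congr 1
  · have h1 : (sphTangent x).mapQ (sphTangent x) T hW = ⟪(x : Amb n), p⟫ • LinearMap.id := by
      ext v
      simp only [LinearMap.comp_apply, Submodule.mkQ_apply, Submodule.mapQ_apply,
        LinearMap.smul_apply, LinearMap.id_apply]
      rw [← Submodule.Quotient.mk_smul, Submodule.Quotient.eq,
        Submodule.mem_orthogonal_singleton_iff_inner_right, inner_sub_right, hT, inner_smul_right]
      ring
    have h2 : Module.finrank ℝ (Amb n ⧸ sphTangent x) = 1 := by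
      have h3 := (sphTangent x).finrank_quotient_add_finrank
      have h4 : Module.finrank ℝ (sphTangent x) = n :=
        Submodule.finrank_orthogonal_span_singleton (sph_ne_zero x)
      rw [h4, finrank_amb] at h3
      omega
    rw [h1, LinearMap.det_smul, h2, LinearMap.det_id, pow_one, mul_one]
  · congr 1
    ext v
    simp [LinearMap.restrict_apply, hA]

/-- An endomorphism with positive definite (not necessarily symmetric) form has positive
determinant. -/
lemma det_pos_of_inner_pos {V : Type*} [NormedAddCommGroup V] [InnerProductSpace ℝ V]
    [FiniteDimensional ℝ V] (A : V →ₗ[ℝ] V) (hA : ∀ v, v ≠ 0 → 0 < ⟪A v, v⟫) :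
    0 < LinearMap.det A := by
  -- The segment from the identity to A stays positive definite, so the determinant never vanishes
  -- along it and keeps the sign it has at the identity.
  let B : ℝ → V →L[ℝ] V := fun s => s • A.toContinuousLinearMap + (1 - s) • .id ℝ V
  have hB : Continuous fun s => (B s).det :=
    ContinuousLinearMap.continuous_det.comp (by fun_prop)
  have hne : ∀ s ∈ Icc (0 : ℝ) 1, (B s).det ≠ 0 := by
    intro s hs h0
    have h1 := LinearMap.bot_lt_ker_of_det_eq_zero (f := (B s : V →ₗ[ℝ] V)) h0
    obtain ⟨v, hv, hv0⟩ := (Submodule.ne_bot_iff _).1 h1.ne'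
    have h2 : s • A v + (1 - s) • v = 0 := by simpa [B] using hv
    have h3 : s * ⟪A v, v⟫ + (1 - s) * ⟪v, v⟫ = 0 := by
      rw [← real_inner_smul_left, ← real_inner_smul_left, ← inner_add_left, h2, inner_zero_left]
    have h4 := hA v hv0
    have h5 : 0 < ⟪v, v⟫ := real_inner_self_pos.2 hv0
    rcases hs.1.eq_or_lt with h | h
    · subst h; simp at h3; exact hv0 h3
    · have := mul_pos h h4
      have := mul_nonneg (sub_nonneg.2 hs.2) h5.le
      linarith
  have h0 : (B 0).det = 1 := by
    simp only [B, ContinuousLinearMap.det]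
    simp
  have h1 : (B 1).det = LinearMap.det A := by
    simp only [B, ContinuousLinearMap.det]
    simp
  by_contra hcon
  rw [← h1, not_lt] at hcon
  obtain ⟨s, hs, hs0⟩ := intermediate_value_Icc' (zero_le_one' ℝ) hB.continuousOn
    ⟨hcon, by rw [h0]; exact zero_le_one⟩
  exact hne s hs hs0

/-! ### Support functions -/

noncomputable section

/-- The support function of a convex body, as a function on the ambient space. -/
def suppFn {n : ℕ} (Ω : ConvexBody (Amb n)) (y : Amb n) : ℝ :=
  sSup ((fun z : Amb n => ⟪y, z⟫) '' (Ω : Set (Amb n)))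

/-- The inverse Gauss map, extended to be constant on rays. -/
def suppPt {n : ℕ} (Ω : ConvexBody (Amb n)) (y : Amb n) : Amb n := gradient (suppFn Ω) y

end

lemma supportFn_zero {n : ℕ} (Ω : ConvexBody (Amb n)) (x : Sph n) :
    supportFn Ω 0 x = suppFn Ω x := by
  simp [supportFn, suppFn]

lemma exists_inner_eq_suppFn {n : ℕ} (Ω : ConvexBody (Amb n)) (y : Amb n) :
    ∃ z ∈ Ω, ⟪y, z⟫ = suppFn Ω y := by
  have h := (Ω.isCompact.image (by fun_prop : Continuous fun z : Amb n => ⟪y, z⟫)).sSup_mem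
    (Ω.nonempty.image _)
  exact h

lemma inner_le_suppFn {n : ℕ} (Ω : ConvexBody (Amb n)) (y : Amb n) {z : Amb n} (hz : z ∈ Ω) :
    ⟪y, z⟫ ≤ suppFn Ω y :=
  le_csSup (Ω.isCompact.image (by fun_prop : Continuous fun z : Amb n => ⟪y, z⟫)).bddAbove
    (mem_image_of_mem _ hz)

lemma suppFn_smul {n : ℕ} (Ω : ConvexBody (Amb n)) {r : ℝ} (hr : 0 < r) (y : Amb n) :
    suppFn Ω (r • y) = r • suppFn Ω y := by
  obtain ⟨z, hz, hzy⟩ := exists_inner_eq_suppFn Ω y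
  obtain ⟨w, hw, hwy⟩ := exists_inner_eq_suppFn Ω (r • y)
  refine le_antisymm ?_ ?_
  · rw [← hwy, real_inner_smul_left, smul_eq_mul]
    exact mul_le_mul_of_nonneg_left (inner_le_suppFn Ω y hw) hr.le
  · rw [← hzy, smul_eq_mul, ← real_inner_smul_left]
    exact inner_le_suppFn Ω _ hz

/-- A compact convex set is the intersection of its supporting half-spaces: a functional separating
z from Ω, normalised to the sphere, would violate the bound. -/
lemma mem_of_forall_inner_le_suppFn {n : ℕ} (Ω : ConvexBody (Amb n)) {z : Amb n}
    (h : ∀ x : Sph n, ⟪(x : Amb n), z⟫ ≤ suppFn Ω x) : z ∈ Ω := by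
  by_contra hz
  obtain ⟨f, c, hfc, hcz⟩ := geometric_hahn_banach_closed_point Ω.convex Ω.isCompact.isClosed hz
  set y := (InnerProductSpace.toDual ℝ (Amb n)).symm f with hy
  have hfy : ∀ w, f w = ⟪y, w⟫ := fun w => by simp [hy]
  have hy0 : y ≠ 0 := by
    rintro h0
    obtain ⟨w, hw⟩ := Ω.nonempty
    have := hfc w hw
    rw [hfy, h0, inner_zero_left] at this hcz
    linarith
  obtain ⟨w, hw, hwy⟩ := exists_inner_eq_suppFn Ω y
  have h1 := h (sphNormalize y hy0)
  have hpos : 0 < ‖y‖⁻¹ := inv_pos.2 (norm_pos_iff.2 hy0)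
  simp only [sphNormalize] at h1
  rw [suppFn_smul Ω hpos, real_inner_smul_left, smul_eq_mul, ← hwy] at h1
  have h2 := le_of_mul_le_mul_left h1 hpos
  have h3 := hfc w hw
  rw [hfy] at h3 hcz
  linarith

lemma radialExt_coe {n : ℕ} (u : Sph n → ℝ) (x : Sph n) : radialExt u x = u x := by
  rw [radialExt, dif_pos (sph_ne_zero x)]
  congr 1
  ext1
  simp [sphNormalize]

lemma suppFn_eq_norm_mul {n : ℕ} (Ω : ConvexBody (Amb n)) {y : Amb n} (hy : y ≠ 0) :
    suppFn Ω y = ‖y‖ * radialExt (supportFn Ω 0) y := by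
  have hpos : 0 < ‖y‖ := norm_pos_iff.2 hy
  rw [radialExt, dif_pos hy, supportFn_zero, sphNormalize, suppFn_smul Ω (inv_pos.2 hpos),
    smul_eq_mul, mul_inv_cancel_left₀ hpos.ne']

/-- The radial extension of a smooth function on the sphere is smooth off the origin. -/
lemma contDiffOn_radialExt {n : ℕ} {u : Sph n → ℝ} (hu : ContMDiff (𝓡 n) 𝓘(ℝ, ℝ) ∞ u) :
    ContDiffOn ℝ ∞ (radialExt u) {0}ᶜ := by
  let U : TopologicalSpace.Opens (Amb n) := ⟨{0}ᶜ, isOpen_compl_singleton⟩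
  have h1 : ContMDiff 𝓘(ℝ, Amb n) 𝓘(ℝ, Amb n) ∞ (fun y : U => ‖(y : Amb n)‖⁻¹ • (y : Amb n)) := by
    intro y
    have hy : (y : Amb n) ≠ 0 := y.2
    have h2 : ContDiffAt ℝ ∞ (fun y : Amb n => ‖y‖⁻¹ • y) y :=
      ((contDiffAt_norm ℝ hy).inv (norm_ne_zero_iff.2 hy)).smul contDiffAt_id
    exact contMDiffAt_subtype_iff.2 h2.contMDiffAt
  have h2 := h1.codRestrict_sphere (n := n) (fun y => by
    have hy : ‖(y : Amb n)‖ ≠ 0 := norm_ne_zero_iff.2 y.2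
    simp [norm_smul, hy])
  have h3 := hu.comp h2
  intro y hy
  have h4 : ContMDiffAt 𝓘(ℝ, Amb n) 𝓘(ℝ, ℝ) ∞ (radialExt u) y := by
    refine (contMDiffAt_subtype_iff (U := U) (x := ⟨y, hy⟩)).1 ?_
    refine (h3 ⟨y, hy⟩).congr_of_eventuallyEq (.of_forall fun z => ?_)
    have hz : (z : Amb n) ≠ 0 := z.2
    simp only [radialExt, dif_pos hz]
    rfl
  exact h4.contDiffAt.contDiffWithinAt

lemma contDiffOn_gradient {n : ℕ} {F : Amb n → ℝ} {s : Set (Amb n)} (hs : IsOpen s)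
    (hF : ContDiffOn ℝ ∞ F s) : ContDiffOn ℝ ∞ (gradient F) s :=
  ((InnerProductSpace.toDual ℝ (Amb n)).symm.contDiff (n := ∞)).comp_contDiffOn
    (hF.fderiv_of_isOpen hs (by simp))

/-! ### The inverse Gauss map and its differential. -/

section Smooth

variable {n : ℕ} {Ω : ConvexBody (Amb n)} (hu : ContMDiff (𝓡 n) 𝓘(ℝ, ℝ) ∞ (supportFn Ω 0))
include hu

lemma contDiffOn_suppFn : ContDiffOn ℝ ∞ (suppFn Ω) {0}ᶜ := by
  have h1 : ContDiffOn ℝ ∞ (fun y : Amb n => ‖y‖ * radialExt (supportFn Ω 0) y) {0}ᶜ :=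
    ContDiffOn.mul (fun y hy => (contDiffAt_norm ℝ hy).contDiffWithinAt) (contDiffOn_radialExt hu)
  exact h1.congr fun y hy => suppFn_eq_norm_mul Ω hy

lemma hasFDerivAt_suppFn {y : Amb n} (hy : y ≠ 0) :
    HasFDerivAt (suppFn Ω) (innerSL ℝ (suppPt Ω y)) y := by
  have h1 : DifferentiableAt ℝ (suppFn Ω) y :=
    ((contDiffOn_suppFn hu).contDiffAt (isOpen_compl_singleton.mem_nhds hy)).differentiableAt
      (by simp)
  exact h1.hasGradientAt.hasFDerivAt

/-- The function y' ↦ `suppFn Ω y'` - ⟨z, y'⟩ is non-negative and vanishes at y, so its gradient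
vanishes there. Differentiability thus makes the maximiser unique. -/
lemma eq_suppPt {y z : Amb n} (hy : y ≠ 0) (hz : z ∈ Ω) (hzy : ⟪y, z⟫ = suppFn Ω y) :
    z = suppPt Ω y := by
  have h1 : HasFDerivAt (fun y' => suppFn Ω y' - ⟪z, y'⟫)
      (innerSL ℝ (suppPt Ω y) - innerSL ℝ z) y :=
    (hasFDerivAt_suppFn hu hy).sub (innerSL ℝ z).hasFDerivAt
  have h2 : IsLocalMin (fun y' => suppFn Ω y' - ⟪z, y'⟫) y := .of_forall fun y' => by
    have := inner_le_suppFn Ω y' hz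
    simp only [← hzy, real_inner_comm z] at this ⊢
    rw [real_inner_comm]
    linarith
  have h3 := h2.hasFDerivAt_eq_zero h1
  rw [← map_sub] at h3
  have h4 : suppPt Ω y - z = 0 := by
    have := congrArg (fun f : Amb n →L[ℝ] ℝ => f (suppPt Ω y - z)) h3
    simpa only [innerSL_apply_apply, zero_apply, inner_self_eq_zero]
      using this
  exact (sub_eq_zero.1 h4).symm

lemma suppPt_mem {y : Amb n} (hy : y ≠ 0) : suppPt Ω y ∈ Ω := by
  obtain ⟨z, hz, hzy⟩ := exists_inner_eq_suppFn Ω y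
  exact eq_suppPt hu hy hz hzy ▸ hz

lemma inner_suppPt {y : Amb n} (hy : y ≠ 0) : ⟪y, suppPt Ω y⟫ = suppFn Ω y := by
  obtain ⟨z, hz, hzy⟩ := exists_inner_eq_suppFn Ω y
  exact eq_suppPt hu hy hz hzy ▸ hzy

lemma suppPt_smul {r : ℝ} (hr : 0 < r) {y : Amb n} (hy : y ≠ 0) :
    suppPt Ω (r • y) = suppPt Ω y := by
  refine (eq_suppPt hu (smul_ne_zero hr.ne' hy) (suppPt_mem hu hy) ?_).symm
  rw [real_inner_smul_left, inner_suppPt hu hy, suppFn_smul Ω hr, smul_eq_mul]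

lemma contDiffOn_suppPt : ContDiffOn ℝ ∞ (suppPt Ω) {0}ᶜ :=
  contDiffOn_gradient isOpen_compl_singleton (contDiffOn_suppFn hu)

lemma hasFDerivAt_suppPt {y : Amb n} (hy : y ≠ 0) :
    HasFDerivAt (suppPt Ω) (fderiv ℝ (suppPt Ω) y) y :=
  (((contDiffOn_suppPt hu).contDiffAt (isOpen_compl_singleton.mem_nhds hy)).differentiableAt
    (by simp)).hasFDerivAt

lemma continuousOn_fderiv_suppPt : ContinuousOn (fderiv ℝ (suppPt Ω)) {0}ᶜ :=
  (contDiffOn_suppPt hu).continuousOn_fderiv_of_isOpen isOpen_compl_singleton (by simp)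

/-- Differentiate ⟨y, X(y)⟩ = `suppFn Ω y` and subtract ⟨X(y), v⟩, which is already the derivative
of the right side. -/
lemma inner_fderiv_suppPt {y : Amb n} (hy : y ≠ 0) (v : Amb n) :
    ⟪y, fderiv ℝ (suppPt Ω) y v⟫ = 0 := by
  have h1 := (hasFDerivAt_id (𝕜 := ℝ) y).inner ℝ (hasFDerivAt_suppPt hu hy)
  have h2 : (fun t => ⟪id t, suppPt Ω t⟫) =ᶠ[nhds y] suppFn Ω := by
    filter_upwards [isOpen_compl_singleton.mem_nhds hy] with t ht using inner_suppPt hu ht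
  have h3 := (h1.congr_of_eventuallyEq h2.symm).unique (hasFDerivAt_suppFn hu hy)
  have h4 := congrArg (fun f : Amb n →L[ℝ] ℝ => f v) h3
  simp [real_inner_comm] at h4
  exact h4

lemma fderiv_suppPt_smul {r : ℝ} (hr : 0 < r) {y : Amb n} (hy : y ≠ 0) :
    fderiv ℝ (suppPt Ω) (r • y) = r⁻¹ • fderiv ℝ (suppPt Ω) y := by
  have h1 := fderiv_comp_smul (f := suppPt Ω) (x := y) r
  have h2 : (fun y => suppPt Ω (r • y)) =ᶠ[nhds y] suppPt Ω := by
    filter_upwards [isOpen_compl_singleton.mem_nhds hy] with t ht using suppPt_smul hu hr ht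
  rw [h2.fderiv_eq] at h1
  rw [h1, smul_smul, inv_mul_cancel₀ hr.ne', one_smul]

/-- The differential of the inverse Gauss map is the inverse Weingarten map. -/
lemma coe_inverseWeingarten (x : Sph n) (v : sphTangent x) :
    ((inverseWeingarten (supportFn Ω 0) x v : sphTangent x) : Amb n) =
      fderiv ℝ (suppPt Ω) x v := by
  set R := radialExt (supportFn Ω 0) with hR
  have hx : (x : Amb n) ≠ 0 := sph_ne_zero x
  have hRd : ∀ y ≠ 0, HasFDerivAt R (innerSL ℝ (gradient R y)) y := fun y hy =>
    (((contDiffOn_radialExt hu).contDiffAt (isOpen_compl_singleton.mem_nhds hy)).differentiableAt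
      (by simp)).hasGradientAt.hasFDerivAt
  have hGd : HasFDerivAt (gradient R) (fderiv ℝ (gradient R) x) (x : Amb n) :=
    (((contDiffOn_gradient isOpen_compl_singleton (contDiffOn_radialExt hu)).contDiffAt
      (isOpen_compl_singleton.mem_nhds hx)).differentiableAt (by simp)).hasFDerivAt
  -- The product rule applied to `suppFn Ω y` = ‖y‖ R(y).
  have hX : suppPt Ω =ᶠ[nhds (x : Amb n)]
      fun y => ‖y‖ • gradient R y + (R y * ‖y‖⁻¹) • y := by
    filter_upwards [isOpen_compl_singleton.mem_nhds hx] with y hy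
    have h1 : HasFDerivAt (suppFn Ω) (‖y‖ • innerSL ℝ (gradient R y) +
        R y • (‖y‖⁻¹ • innerSL ℝ y)) y := by
      refine ((HasFDerivAt_norm hy).mul (hRd y hy)).congr_of_eventuallyEq ?_
      filter_upwards [isOpen_compl_singleton.mem_nhds hy] with z hz using suppFn_eq_norm_mul Ω hz
    have h2 := (hasFDerivAt_suppFn hu hy).unique h1
    refine ext_inner_right ℝ fun w => ?_
    have h3 := congrArg (fun f : Amb n →L[ℝ] ℝ => f w) h2
    simp at h3
    rw [h3, inner_add_left, real_inner_smul_left, real_inner_smul_left]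
    simp
    ring
  have hxv : ⟪(x : Amb n), (v : Amb n)⟫ = 0 :=
    Submodule.mem_orthogonal_singleton_iff_inner_right.1 v.2
  have hinv : HasFDerivAt (fun y : Amb n => ‖y‖⁻¹) (-(‖(x : Amb n)‖ ^ 2)⁻¹ •
      (‖(x : Amb n)‖⁻¹ • innerSL ℝ (x : Amb n))) (x : Amb n) :=
    (hasDerivAt_inv (norm_ne_zero_iff.2 hx)).comp_hasFDerivAt (x : Amb n) (HasFDerivAt_norm hx)
  have hD := ((HasFDerivAt_norm hx).smul hGd).add
    (((hRd x hx).mul hinv).smul (hasFDerivAt_id (𝕜 := ℝ) (x : Amb n)))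
  have hD' := (hasFDerivAt_suppPt hu hx).unique (hD.congr_of_eventuallyEq hX)
  have hval : fderiv ℝ (suppPt Ω) x v = fderiv ℝ (gradient R) x v +
      (⟪gradient R x, (v : Amb n)⟫ • (x : Amb n) + R x • (v : Amb n)) := by
    rw [hD']
    simp [hxv]
    abel
  have hmem : fderiv ℝ (suppPt Ω) x v ∈ sphTangent x :=
    Submodule.mem_orthogonal_singleton_iff_inner_right.2 (inner_fderiv_suppPt hu hx v)
  -- Projection to x^⊥ kills the multiple of x and fixes the left side, which is tangent; what is
  -- left is Hess u + u id.
  have hproj := congrArg (fun w => ((sphTangent x).orthogonalProjectionOnto w : Amb n)) hval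
  simp only [map_add, map_smul] at hproj
  rw [Submodule.orthogonalProjectionOnto_orthogonalComplement_singleton_eq_zero,
    Submodule.orthogonalProjectionOnto_mem_subspace_eq_self,
    (sphTangent x).orthogonalProjectionOnto_mem_subspace_eq_self ⟨_, hmem⟩] at hproj
  simp only [smul_zero, zero_add] at hproj
  rw [hproj, hR, radialExt_coe]
  rfl

end Smooth

/-! ### The soliton equation as a Jacobian identity. -/

section Soliton

variable {n : ℕ} {Ω : ConvexBody (Amb n)} (hsol : IsSoliton (supportFn Ω 0))
include hsol

/-- Positive definiteness gives a positive determinant, so the inverse in `gaussCurvature` is a true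
inverse and u = K is positive. -/
lemma suppFn_mul_det (x : Sph n) :
    0 < suppFn Ω x ∧
      suppFn Ω x * LinearMap.det (inverseWeingarten (supportFn Ω 0) x) = 1 := by
  have h1 := det_pos_of_inner_pos _ (hsol.posDef x)
  have h2 := hsol.eq_gaussCurvature x
  rw [supportFn_zero, gaussCurvature] at h2
  rw [h2]
  exact ⟨inv_pos.2 h1, inv_mul_cancel₀ h1.ne'⟩

lemma suppFn_pos {y : Amb n} (hy : y ≠ 0) : 0 < suppFn Ω y := by
  have hpos : 0 < ‖y‖ := norm_pos_iff.2 hy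
  have h := (suppFn_mul_det hsol (sphNormalize y hy)).1
  rw [sphNormalize, suppFn_smul Ω (inv_pos.2 hpos), smul_eq_mul] at h
  exact pos_of_mul_pos_right h (inv_pos.2 hpos).le

/-- The Jacobian of the inverse Gauss map, with prescribed value in the normal direction. -/
lemma suppFn_mul_det_add (x : Sph n) (p : Amb n) :
    suppFn Ω x * (fderiv ℝ (suppPt Ω) x + (innerSL ℝ (x : Amb n)).smulRight p).det =
      ⟪(x : Amb n), p⟫ := by
  -- Two choices of p matter later: p = x gives Jacobian 1/u along normal rays, and p = X(x) gives
  -- Jacobian 1 for the cone map.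
  have h := det_eq_inner_mul_det x
    (fderiv ℝ (suppPt Ω) x + (innerSL ℝ (x : Amb n)).smulRight p : Amb n →L[ℝ] Amb n) p
    (inverseWeingarten (supportFn Ω 0) x)
    (fun v => by
      have hxv : ⟪(x : Amb n), (v : Amb n)⟫ = 0 :=
        Submodule.mem_orthogonal_singleton_iff_inner_right.1 v.2
      simp [hxv, coe_inverseWeingarten hsol.smooth])
    (fun v => by
      simp [inner_add_right, inner_smul_right, inner_fderiv_suppPt hsol.smooth (sph_ne_zero x)])
  rw [ContinuousLinearMap.det, h, mul_left_comm, (suppFn_mul_det hsol x).2, mul_one]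

end Soliton

/-! ### An upper bound for the first variation of volume. -/

instance compactSpace_sph (n : ℕ) : CompactSpace (Sph n) :=
  isCompact_iff_compactSpace.1 (isCompact_sphere _ _)

/-- The Lebesgue integral over a spherical shell of a radially weighted function. -/
lemma lintegral_shell {n : ℕ} {k c : Sph n → ℝ} (hk : Continuous k) (hc : Continuous c)
    (hk0 : ∀ x, 0 ≤ k x) (hc0 : ∀ x, 0 ≤ c x) {φ : Amb n → ENNReal}
    (hφ : ∀ x : Sph n, ∀ r : ℝ, 1 < r → r ≤ 1 + k x →
      φ (r • (x : Amb n)) ≤ ENNReal.ofReal (c x / r ^ n)) :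
    ∫⁻ y in (fun p : Sph n × Ioi (0 : ℝ) => (p.2 : ℝ) • (p.1 : Amb n)) ''
      {p | 1 < (p.2 : ℝ) ∧ (p.2 : ℝ) ≤ 1 + k p.1}, φ y ≤
      ENNReal.ofReal (∫ x, c x * k x ∂(sphMeasure n)) := by
  set P : Set (Sph n × Ioi (0 : ℝ)) := {p | 1 < (p.2 : ℝ) ∧ (p.2 : ℝ) ≤ 1 + k p.1} with hP
  have hPm : MeasurableSet P :=
    (measurableSet_lt measurable_const (measurable_subtype_coe.comp measurable_snd)).inter
      (measurableSet_le (measurable_subtype_coe.comp measurable_snd)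
        (measurable_const.add (hk.measurable.comp measurable_fst)))
  rw [← (measurePreserving_polar n).setLIntegral_comp_emb (measurableEmbedding_polar n)]
  have hm : Measurable fun p : Sph n × Ioi (0 : ℝ) => ENNReal.ofReal (c p.1 / (p.2 : ℝ) ^ n) :=
    ((hc.measurable.comp measurable_fst).div
      ((measurable_subtype_coe.comp measurable_snd).pow_const n)).ennreal_ofReal
  calc ∫⁻ p in P, φ ((p.2 : ℝ) • (p.1 : Amb n)) ∂((sphMeasure n).prod (Measure.volumeIoiPow n))
      ≤ ∫⁻ p in P, ENNReal.ofReal (c p.1 / (p.2 : ℝ) ^ n)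
          ∂((sphMeasure n).prod (Measure.volumeIoiPow n)) :=
        setLIntegral_mono' hPm fun p hp => hφ p.1 p.2 hp.1 hp.2
    _ = ∫⁻ x, ENNReal.ofReal (c x * k x) ∂(sphMeasure n) := by
        rw [← lintegral_indicator hPm, lintegral_prod _ (hm.indicator hPm).aemeasurable]
        refine lintegral_congr fun x => ?_
        have h1 : ∀ r : Ioi (0 : ℝ), P.indicator
            (fun p : Sph n × Ioi (0 : ℝ) => ENNReal.ofReal (c p.1 / (p.2 : ℝ) ^ n)) (x, r) =
            (Ioc 1 (1 + k x)).indicator (fun r => ENNReal.ofReal (c x / r ^ n)) (r : ℝ) := by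
          intro r
          by_cases hr : (r : ℝ) ∈ Ioc 1 (1 + k x)
          · rw [indicator_of_mem hr, indicator_of_mem (show (x, r) ∈ P from hr)]
          · rw [indicator_of_notMem hr, indicator_of_notMem (show (x, r) ∉ P from hr)]
        simp_rw [h1]
        rw [lintegral_volumeIoiPow n
          (fun r => (Ioc 1 (1 + k x)).indicator (fun r => ENNReal.ofReal (c x / r ^ n)) r)]
        have h2 : ∀ r : ℝ, ENNReal.ofReal (r ^ n) *
            (Ioc 1 (1 + k x)).indicator (fun r => ENNReal.ofReal (c x / r ^ n)) r =
            (Ioc 1 (1 + k x)).indicator (fun _ => ENNReal.ofReal (c x)) r := by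
          intro r
          by_cases hr : r ∈ Ioc 1 (1 + k x)
          · have hr0 : 0 < r ^ n := pow_pos (by linarith [hr.1]) n
            rw [indicator_of_mem hr, indicator_of_mem hr, ← ENNReal.ofReal_mul hr0.le,
              mul_div_cancel₀ _ hr0.ne']
          · rw [indicator_of_notMem hr, indicator_of_notMem hr, mul_zero]
        simp_rw [h2]
        rw [lintegral_indicator measurableSet_Ioc, Measure.restrict_restrict measurableSet_Ioc,
          (inter_eq_left.2 (fun r hr => lt_trans one_pos hr.1) :
            Ioc 1 (1 + k x) ∩ Ioi 0 = Ioc 1 (1 + k x)), setLIntegral_const,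
          Real.volume_Ioc, add_sub_cancel_left, ENNReal.ofReal_mul (hc0 x)]
    _ = ENNReal.ofReal (∫ x, c x * k x ∂(sphMeasure n)) :=
        (ofReal_integral_eq_lintegral_ofReal (hc.mul hk).integrable_sph
          (.of_forall fun x => mul_nonneg (hc0 x) (hk0 x))).symm

lemma continuous_suppFn_sph {n : ℕ} {Ω : ConvexBody (Amb n)}
    (hu : ContMDiff (𝓡 n) 𝓘(ℝ, ℝ) ∞ (supportFn Ω 0)) :
    Continuous fun x : Sph n => suppFn Ω x := by
  have h := hu.continuous
  rwa [show supportFn Ω 0 = fun x : Sph n => suppFn Ω x from funext (supportFn_zero Ω)] at h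

open scoped Pointwise in
/-- Points of `Ω + εL` outside `Ω` lie on an outer normal ray, within the distance given by the
support function of `L`. -/
lemma exists_eq_suppPt_add {n : ℕ} {Ω : ConvexBody (Amb n)}
    (hu : ContMDiff (𝓡 n) 𝓘(ℝ, ℝ) ∞ (supportFn Ω 0)) {L : Set (Amb n)} {h : Sph n → ℝ}
    (hL : ∀ z ∈ L, ∀ x : Sph n, ⟪(x : Amb n), z⟫ ≤ h x) {ε : ℝ} (hε : 0 ≤ ε) {p : Amb n}
    (hp : p ∈ (Ω : Set (Amb n)) + ε • L) (hpΩ : p ∉ Ω) :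
    ∃ x : Sph n, ∃ s : ℝ, 0 < s ∧ s ≤ ε * h x ∧ p = suppPt Ω x + s • (x : Amb n) := by
  -- q is the point of Ω nearest to p; the direction of p - q is an outer normal at q, so q = X(x).
  obtain ⟨q, hq, hpq⟩ := exists_norm_eq_iInf_of_complete_convex Ω.nonempty
    Ω.isCompact.isClosed.isComplete Ω.convex p
  have hin := (norm_eq_iInf_iff_real_inner_le_zero Ω.convex hq).1 hpq
  have hd : p - q ≠ 0 := fun h0 => hpΩ (by rw [sub_eq_zero.1 h0]; exact hq)
  have hs : 0 < ‖p - q‖ := norm_pos_iff.2 hd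
  set x := sphNormalize (p - q) hd with hx
  have hxq : ⟪(x : Amb n), q⟫ = suppFn Ω x := by
    obtain ⟨w, hw, hwx⟩ := exists_inner_eq_suppFn Ω (x : Amb n)
    refine le_antisymm (inner_le_suppFn Ω _ hq) ?_
    have h1 := hin w hw
    rw [← hwx]
    have h2 : ⟪(x : Amb n), w - q⟫ ≤ 0 := by
      simp only [hx, sphNormalize]
      rw [real_inner_smul_left]
      exact mul_nonpos_of_nonneg_of_nonpos (inv_pos.2 hs).le h1
    rw [inner_sub_right] at h2
    linarith
  have hp' : p = q + ‖p - q‖ • (x : Amb n) := by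
    simp only [hx, sphNormalize]
    rw [smul_smul, mul_inv_cancel₀ hs.ne', one_smul, add_sub_cancel]
  refine ⟨x, ‖p - q‖, hs, ?_, ?_⟩
  · obtain ⟨w, hw, _, ⟨z, hz, rfl⟩, hwz⟩ := hp
    have h1 : ⟪(x : Amb n), p⟫ = suppFn Ω x + ‖p - q‖ := by
      rw [hp', inner_add_right, hxq, inner_smul_right, inner_self_sph, mul_one, ← hp']
    have h2 : ⟪(x : Amb n), p⟫ ≤ suppFn Ω x + ε * h x := by
      rw [← hwz]
      simp only [inner_add_right, inner_smul_right]
      exact add_le_add (inner_le_suppFn Ω _ hw) (mul_le_mul_of_nonneg_left (hL z hz x) hε)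
    linarith
  · rw [← eq_suppPt hu (sph_ne_zero x) hq hxq]
    exact hp'

section Soliton

variable {n : ℕ} {Ω : ConvexBody (Amb n)} (hsol : IsSoliton (supportFn Ω 0))
include hsol

/-- The parametrization `rx ↦ X(x) + (r - 1) x` of the exterior of `Ω` by the normal bundle and the
value of its Jacobian on the boundary. -/
lemma exists_fderiv_normalMap : ∃ G' : Amb n → Amb n →L[ℝ] Amb n,
    (∀ y ≠ 0, HasFDerivAt (fun y => suppPt Ω y + (y - ‖y‖⁻¹ • y)) (G' y) y) ∧
    ContinuousOn G' {0}ᶜ ∧ ∀ x : Sph n, (G' x).det = (suppFn Ω x)⁻¹ := by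
  let G : Amb n → Amb n := fun y => suppPt Ω y + (y - ‖y‖⁻¹ • y)
  let G' : Amb n → Amb n →L[ℝ] Amb n := fun y => fderiv ℝ (suppPt Ω) y +
    (ContinuousLinearMap.id ℝ (Amb n) - (‖y‖⁻¹ • ContinuousLinearMap.id ℝ (Amb n) +
      (-(‖y‖ ^ 2)⁻¹ • (‖y‖⁻¹ • innerSL ℝ y)).smulRight y))
  have hG : ∀ y ≠ 0, HasFDerivAt G (G' y) y := by
    intro y hy
    have h1 : HasFDerivAt (fun y : Amb n => ‖y‖⁻¹) (-(‖y‖ ^ 2)⁻¹ • (‖y‖⁻¹ • innerSL ℝ y)) y :=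
      (hasDerivAt_inv (norm_ne_zero_iff.2 hy)).comp_hasFDerivAt y (HasFDerivAt_norm hy)
    exact (hasFDerivAt_suppPt hsol.smooth hy).add
      ((hasFDerivAt_id y).sub (h1.smul (hasFDerivAt_id y)))
  have hG'c : ContinuousOn G' {0}ᶜ := by
    have h1 : ContinuousOn (fun y : Amb n => ‖y‖⁻¹) {0}ᶜ :=
      continuous_norm.continuousOn.inv₀ fun y hy => norm_ne_zero_iff.2 hy
    have h2 : ContinuousOn (fun y : Amb n => (‖y‖ ^ 2)⁻¹) {0}ᶜ :=
      (continuous_norm.pow 2).continuousOn.inv₀ fun y hy =>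
        pow_ne_zero 2 (norm_ne_zero_iff.2 hy)
    refine continuousOn_clm_apply.2 fun v => ?_
    have h3 : ContinuousOn (fun y => fderiv ℝ (suppPt Ω) y v + (v - (‖y‖⁻¹ • v +
        (-(‖y‖ ^ 2)⁻¹ * (‖y‖⁻¹ * ⟪y, v⟫)) • y))) {0}ᶜ :=
      ((continuousOn_fderiv_suppPt hsol.smooth).clm_apply continuousOn_const).add
        (continuousOn_const.sub ((h1.smul continuousOn_const).add ((h2.neg.mul (h1.mul
          (by fun_prop : Continuous fun y : Amb n => ⟪y, v⟫).continuousOn)).smul continuousOn_id)))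
    exact h3
  have hdet : ∀ x : Sph n, (G' x).det = (suppFn Ω x)⁻¹ := by
    intro x
    -- At a unit vector x the derivative of y - y/‖y‖ is the orthogonal projection to the line
    -- through x.
    have h1 : G' x = fderiv ℝ (suppPt Ω) x + (innerSL ℝ (x : Amb n)).smulRight (x : Amb n) := by
      ext1 v
      simp [G']
    have h2 := suppFn_mul_det_add hsol x x
    rw [← h1, inner_self_sph] at h2
    exact eq_inv_of_mul_eq_one_right h2
  exact ⟨G', hG, hG'c, hdet⟩

/-- Continuity of the Jacobian and compactness of the sphere make its boundary value 1/u an upper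
bound up to η in a whole shell; the factor r^n is the polar density. -/
lemma exists_forall_det_le {G' : Amb n → Amb n →L[ℝ] Amb n} (hG'c : ContinuousOn G' {0}ᶜ)
    (hdet : ∀ x : Sph n, (G' x).det = (suppFn Ω x)⁻¹) {η : ℝ} (hη : 0 < η) :
    ∃ δ > 0, ∀ r : ℝ, |r - 1| < δ → ∀ x : Sph n,
      |(G' (r • (x : Amb n))).det| * r ^ n ≤ (suppFn Ω x)⁻¹ + η := by
  have hclose : ∀ᶠ r : ℝ in nhds 1, ∀ x ∈ (univ : Set (Sph n)),
      |(G' (r • (x : Amb n))).det| * r ^ n < (suppFn Ω x)⁻¹ + η := by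
    refine isCompact_univ.eventually_forall_of_forall_eventually fun x _ => ?_
    have h1 : ContinuousAt (fun z : ℝ × Sph n => |(G' (z.1 • (z.2 : Amb n))).det| * z.1 ^ n)
        (1, x) := by
      refine ContinuousAt.mul ?_ (by fun_prop)
      refine ContinuousAt.abs ?_
      have h2 : ContinuousAt G' ((1 : ℝ) • (x : Amb n)) :=
        hG'c.continuousAt (isOpen_compl_singleton.mem_nhds (by simpa using sph_ne_zero x))
      have h3 : ContinuousAt (fun z : ℝ × Sph n => G' (z.1 • (z.2 : Amb n))) (1, x) :=
        ContinuousAt.comp (f := fun z : ℝ × Sph n => z.1 • (z.2 : Amb n)) (x := (1, x)) h2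
          (by fun_prop)
      exact ContinuousLinearMap.continuous_det.continuousAt.comp h3
    have h2 : ContinuousAt (fun z : ℝ × Sph n => (suppFn Ω z.2)⁻¹ + η) (1, x) := by
      have h3 : Continuous fun z : ℝ × Sph n => suppFn Ω z.2 :=
        (continuous_suppFn_sph hsol.smooth).comp continuous_snd
      exact (ContinuousAt.inv₀ h3.continuousAt (suppFn_pos hsol (sph_ne_zero x)).ne').add continuousAt_const
    refine h1.eventually_lt h2 ?_
    have h3 : 0 < (suppFn Ω x)⁻¹ := inv_pos.2 (suppFn_pos hsol (sph_ne_zero x))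
    simp only [one_smul, hdet, abs_of_pos h3, one_pow, mul_one]
    linarith
  obtain ⟨δ, hδ, hclose⟩ := Metric.eventually_nhds_iff.1 hclose
  exact ⟨δ, hδ, fun r hr x => (hclose (by rwa [Real.dist_eq]) x (mem_univ x)).le⟩

open scoped Pointwise in
/-- The first variation of volume: an upper bound for the volume of `Ω + εL`. -/
lemma volume_add_smul_le {L : Set (Amb n)} {h : Sph n → ℝ} (hh : Continuous h)
    (hh0 : ∀ x, 0 ≤ h x) (hL : ∀ z ∈ L, ∀ x : Sph n, ⟪(x : Amb n), z⟫ ≤ h x) {η : ℝ}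
    (hη : 0 < η) : ∃ ε₀ > 0, ∀ ε, 0 < ε → ε ≤ ε₀ →
      volume ((Ω : Set (Amb n)) + ε • L) ≤ volume (Ω : Set (Amb n)) +
        ENNReal.ofReal (ε * ∫ x : Sph n, ((suppFn Ω x)⁻¹ + η) * h x ∂(sphMeasure n)) := by
  obtain ⟨G', hG, hG'c, hdet⟩ := exists_fderiv_normalMap hsol
  obtain ⟨δ, hδ, hclose⟩ := exists_forall_det_le hsol hG'c hdet hη
  set G : Amb n → Amb n := fun y => suppPt Ω y + (y - ‖y‖⁻¹ • y)
  obtain ⟨C, hC⟩ := (isCompact_univ.image hh).bddAbove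
  have hC' : ∀ x, h x ≤ |C| + 1 := fun x =>
    (hC (mem_image_of_mem h (mem_univ x))).trans (by linarith [le_abs_self C])
  have hCpos : 0 < |C| + 1 := by positivity
  -- This bound on ε forces ε h ≤ δ/2, so the shell stays where the Jacobian bound holds.
  refine ⟨δ / 2 / (|C| + 1), by positivity, fun ε hε hεδ => ?_⟩
  set E := (fun p : Sph n × Ioi (0 : ℝ) => (p.2 : ℝ) • (p.1 : Amb n)) ''
      {p | 1 < (p.2 : ℝ) ∧ (p.2 : ℝ) ≤ 1 + ε * h p.1} with hE
  have hEm : MeasurableSet E := by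
    refine (measurableEmbedding_polar n).measurableSet_image.2 ?_
    exact (measurableSet_lt measurable_const (measurable_subtype_coe.comp measurable_snd)).inter
      (measurableSet_le (measurable_subtype_coe.comp measurable_snd)
        (measurable_const.add (measurable_const.mul (hh.measurable.comp measurable_fst))))
  -- A covering by normal segments suffices: the area formula is used only as an upper bound, so
  -- injectivity of G plays no role.
  have hcover : (Ω : Set (Amb n)) + ε • L ⊆ (Ω : Set (Amb n)) ∪ G '' E := by
    intro p hp
    by_cases hpΩ : p ∈ Ω
    · exact .inl hpΩ
    · obtain ⟨x, s, hs, hsh, rfl⟩ := exists_eq_suppPt_add hsol.smooth hL hε.le hp hpΩ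
      have h1 : (0 : ℝ) < 1 + s := by linarith
      refine .inr ⟨(1 + s) • (x : Amb n), ⟨(x, ⟨1 + s, h1⟩), ⟨?_, ?_⟩, rfl⟩, ?_⟩
      · simpa using hs
      · simpa using hsh
      · simp only [G]
        rw [suppPt_smul hsol.smooth h1 (sph_ne_zero x), norm_smul, norm_sph, mul_one,
          Real.norm_of_nonneg h1.le, smul_smul, inv_mul_cancel₀ h1.ne', one_smul, add_smul,
          one_smul, add_sub_cancel_left]
  refine (measure_mono hcover).trans ((measure_union_le _ _).trans (add_le_add le_rfl ?_))
  have hE0 : ∀ y ∈ E, y ≠ 0 := by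
    rintro _ ⟨p, hp, rfl⟩
    exact smul_ne_zero (ne_of_gt p.2.2) (sph_ne_zero p.1)
  refine (addHaar_image_le_lintegral_abs_det_fderiv volume hEm
    (fun y hy => (hG y (hE0 y hy)).hasFDerivWithinAt)).trans ?_
  have hcc : Continuous fun x : Sph n => (suppFn Ω x)⁻¹ + η :=
    ((continuous_suppFn_sph hsol.smooth).inv₀
      fun x => (suppFn_pos hsol (sph_ne_zero x)).ne').add continuous_const
  have hc0 : ∀ x : Sph n, 0 ≤ (suppFn Ω x)⁻¹ + η := fun x =>
    add_nonneg (inv_pos.2 (suppFn_pos hsol (sph_ne_zero x))).le hη.le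
  refine (lintegral_shell (k := fun x => ε * h x) (continuous_const.mul hh) hcc
    (fun x => mul_nonneg hε.le (hh0 x)) hc0 ?_).trans (le_of_eq ?_)
  · intro x r hr1 hr2
    refine ENNReal.ofReal_le_ofReal ?_
    rw [le_div_iff₀ (pow_pos (by linarith) n)]
    refine hclose r ?_ x
    rw [abs_of_pos (by linarith)]
    have h1 : ε * h x ≤ δ / 2 := by
      calc ε * h x ≤ δ / 2 / (|C| + 1) * (|C| + 1) :=
            mul_le_mul hεδ (hC' x) (hh0 x) (by positivity)
        _ = δ / 2 := by field_simp
    linarith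
  · congr 1
    rw [← integral_const_mul]
    refine integral_congr_ae (.of_forall fun x => ?_)
    simp only
    ring

end Soliton

/-! ### Minkowski's first inequality. -/

open scoped Pointwise in
/-- The Brunn–Minkowski inequality for `K + εL` with `K` and `L` of equal volume. -/
lemma one_add_pow_mul_volume_le {n : ℕ} {K L : Set (Amb n)} (hK : IsCompact K) (hL : IsCompact L)
    (hKL : volume L = volume K) {ε : ℝ} (hε : 0 < ε) :
    ENNReal.ofReal ((1 + ε) ^ (n + 1)) * volume K ≤ volume (K + ε • L) := by
  have h1 : 0 < 1 + ε := by linarith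
  -- K + εL = (1 + ε)(sK + tL) with weights s = 1/(1+ε) and t = ε/(1+ε).
  have h2 := volume_le_volume_weighted_add (s := (1 + ε)⁻¹) (t := (1 + ε)⁻¹ * ε) (by positivity)
    (by positivity) (by field_simp) hK hL hKL
  rw [mul_smul, ← smul_add, Measure.addHaar_smul, finrank_amb, abs_of_pos (by positivity)] at h2
  calc ENNReal.ofReal ((1 + ε) ^ (n + 1)) * volume K
      ≤ ENNReal.ofReal ((1 + ε) ^ (n + 1)) *
        (ENNReal.ofReal ((1 + ε)⁻¹ ^ (n + 1)) * volume (K + ε • L)) := by gcongr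
    _ = volume (K + ε • L) := by
        rw [← mul_assoc, ← ENNReal.ofReal_mul (by positivity), ← mul_pow, mul_inv_cancel₀ h1.ne',
          one_pow, ENNReal.ofReal_one, one_mul]

lemma volume_eq_ofReal {n : ℕ} {Ω : ConvexBody (Amb n)}
    (hvol : volume (Ω : Set (Amb n)) = volume (closedBall (0 : Amb n) 1)) :
    volume (Ω : Set (Amb n)) = ENNReal.ofReal ((sphMeasure n).real univ / (n + 1)) := by
  rw [hvol, sphMeasure_real_univ, mul_div_cancel_left₀ _ (by positivity), measureReal_def,
    ENNReal.ofReal_toReal measure_closedBall_lt_top.ne]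

section Soliton

variable {n : ℕ} {Ω : ConvexBody (Amb n)} (hsol : IsSoliton (supportFn Ω 0))
  (hvol : volume (Ω : Set (Amb n)) = volume (closedBall (0 : Amb n) 1))
include hsol

lemma continuous_inv_suppFn_sph : Continuous fun x : Sph n => (suppFn Ω x)⁻¹ :=
  (continuous_suppFn_sph hsol.smooth).inv₀ fun x => (suppFn_pos hsol (sph_ne_zero x)).ne'

include hvol

/-- Minkowski's first inequality for sets of equal volume. -/
lemma sphMeasure_univ_le_integral {L : Set (Amb n)} (hLc : IsCompact L)
    (hLv : volume L = volume (Ω : Set (Amb n))) {h : Sph n → ℝ} (hh : Continuous h)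
    (hh0 : ∀ x, 0 ≤ h x) (hL : ∀ z ∈ L, ∀ x : Sph n, ⟪(x : Amb n), z⟫ ≤ h x) :
    (sphMeasure n).real univ ≤ ∫ x : Sph n, (suppFn Ω x)⁻¹ * h x ∂(sphMeasure n) := by
  have hV := volume_eq_ofReal hvol
  have hv : 0 < (sphMeasure n).real univ / (n + 1) :=
    div_pos (sphMeasure_real_univ_pos n) (by positivity)
  have hB : 0 ≤ ∫ x, h x ∂(sphMeasure n) := integral_nonneg hh0
  have key : ∀ η > 0, (sphMeasure n).real univ ≤
      (∫ x : Sph n, (suppFn Ω x)⁻¹ * h x ∂(sphMeasure n)) + η * ∫ x, h x ∂(sphMeasure n) := by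
    intro η hη
    obtain ⟨ε, hε, hle⟩ := volume_add_smul_le hsol hh hh0 hL hη
    have h1 := (one_add_pow_mul_volume_le Ω.isCompact hLc hLv hε).trans (hle ε hε le_rfl)
    have hI0 : 0 ≤ ∫ x : Sph n, ((suppFn Ω x)⁻¹ + η) * h x ∂(sphMeasure n) :=
      integral_nonneg fun x => mul_nonneg
        (add_nonneg (inv_pos.2 (suppFn_pos hsol (sph_ne_zero x))).le hη.le) (hh0 x)
    rw [hV, ← ENNReal.ofReal_mul (by positivity), ← ENNReal.ofReal_add hv.le (by positivity),
      ENNReal.ofReal_le_ofReal_iff (by positivity)] at h1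
    have h2 : (∫ x : Sph n, ((suppFn Ω x)⁻¹ + η) * h x ∂(sphMeasure n)) =
        (∫ x : Sph n, (suppFn Ω x)⁻¹ * h x ∂(sphMeasure n)) + η * ∫ x, h x ∂(sphMeasure n) := by
      have hi1 : Integrable (fun x : Sph n => (suppFn Ω x)⁻¹ * h x) (sphMeasure n) :=
        ((continuous_inv_suppFn_sph hsol).mul hh).integrable_sph
      have hi2 : Integrable (fun x : Sph n => η * h x) (sphMeasure n) :=
        (continuous_const.mul hh).integrable_sph
      rw [← integral_const_mul, ← integral_add hi1 hi2]
      simp_rw [add_mul]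
    rw [h2] at h1
    -- By Bernoulli, (1+ε)^(n+1) V ≥ V + ε(n+1)V, and (n+1)V = ω; subtracting V and dividing by ε
    -- gives the bound.
    have h3 := one_add_mul_le_pow (show (-2 : ℝ) ≤ ε by linarith) (n + 1)
    have h4 := mul_le_mul_of_nonneg_right h3 hv.le
    have h5 : ε * (sphMeasure n).real univ = (n + 1 : ℕ) * ε * ((sphMeasure n).real univ / (n + 1)) := by
      push_cast
      field_simp
    have h6 : ε * (sphMeasure n).real univ ≤ ε * ((∫ x : Sph n, (suppFn Ω x)⁻¹ * h x
        ∂(sphMeasure n)) + η * ∫ x, h x ∂(sphMeasure n)) := by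
      rw [h5]; linarith
    exact le_of_mul_le_mul_left h6 hε
  refine le_of_forall_pos_le_add fun δ hδ => ?_
  refine (key (δ / ((∫ x, h x ∂(sphMeasure n)) + 1)) (by positivity)).trans ?_
  gcongr
  rw [div_mul_eq_mul_div, div_le_iff₀ (by positivity)]
  nlinarith

open scoped Pointwise in
/-- **Minkowski's first inequality.** -/
theorem le_integral_pow {L : Set (Amb n)} (hLc : IsCompact L) {D : ℝ} (hD : 0 < D)
    (hLD : ENNReal.ofReal D * volume (Ω : Set (Amb n)) ≤ volume L) {h : Sph n → ℝ}
    (hh : Continuous h) (hh0 : ∀ x, 0 ≤ h x)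
    (hL : ∀ z ∈ L, ∀ x : Sph n, ⟪(x : Amb n), z⟫ ≤ h x) :
    D ≤ (((sphMeasure n).real univ)⁻¹ *
      ∫ x : Sph n, (suppFn Ω x)⁻¹ * h x ∂(sphMeasure n)) ^ (n + 1) := by
  have hω := sphMeasure_real_univ_pos n
  set v := (sphMeasure n).real univ / (n + 1) with hv
  have hv0 : 0 < v := div_pos hω (by positivity)
  have hV : volume (Ω : Set (Amb n)) = ENNReal.ofReal v := volume_eq_ofReal hvol
  set l := volume.real L with hl
  have hLl : volume L = ENNReal.ofReal l := (ENNReal.ofReal_toReal hLc.measure_lt_top.ne).symm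
  rw [hV, hLl, ← ENNReal.ofReal_mul hD.le, ENNReal.ofReal_le_ofReal_iff measureReal_nonneg] at hLD
  have hl0 : 0 < l := lt_of_lt_of_le (by positivity) hLD
  -- Scaling by 1/c gives L the volume of Ω.
  set c := (l / v) ^ ((n + 1 : ℕ) : ℝ)⁻¹ with hc
  have hc0 : 0 < c := Real.rpow_pos_of_pos (div_pos hl0 hv0) _
  have hcN : c ^ (n + 1) = l / v := Real.rpow_inv_natCast_pow (div_pos hl0 hv0).le (by omega)
  have h1 := sphMeasure_univ_le_integral hsol hvol (hLc.smul c⁻¹) (h := fun x => c⁻¹ * h x)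
    (by
      rw [Measure.addHaar_smul, finrank_amb, hLl, hV, abs_of_pos (by positivity),
        ← ENNReal.ofReal_mul (by positivity), inv_pow, hcN]
      congr 1
      field_simp)
    (continuous_const.mul hh) (fun x => mul_nonneg (by positivity) (hh0 x))
    (by
      rintro _ ⟨z, hz, rfl⟩ x
      simp only [inner_smul_right]
      exact mul_le_mul_of_nonneg_left (hL z hz x) (by positivity))
  have h2 : (∫ x : Sph n, (suppFn Ω x)⁻¹ * (c⁻¹ * h x) ∂(sphMeasure n)) =
      c⁻¹ * ∫ x : Sph n, (suppFn Ω x)⁻¹ * h x ∂(sphMeasure n) := by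
    rw [← integral_const_mul]
    refine integral_congr_ae (.of_forall fun x => ?_)
    simp only
    ring
  rw [h2, inv_mul_eq_div, le_div_iff₀ hc0] at h1
  have h3 : c ≤ ((sphMeasure n).real univ)⁻¹ *
      ∫ x : Sph n, (suppFn Ω x)⁻¹ * h x ∂(sphMeasure n) := by
    rw [inv_mul_eq_div, le_div_iff₀ hω, mul_comm]
    exact h1
  calc D ≤ l / v := by rw [le_div_iff₀ hv0]; exact hLD
    _ = c ^ (n + 1) := hcN.symm
    _ ≤ _ := pow_le_pow_left₀ hc0.le h3 _

/-! ### Uniform cone measure and volumes of projective images. -/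

/-- The map `rx ↦ r X(x)` transports Lebesgue measure on the unit ball to Lebesgue measure
on `Ω`. -/
lemma setLIntegral_eq_setLIntegral_ball {f : Amb n → ENNReal} (hf : Measurable f) :
    ∫⁻ z in (Ω : Set (Amb n)), f z =
      ∫⁻ y in closedBall (0 : Amb n) 1 \ {0}, f (‖y‖ • suppPt Ω y) := by
  set B := closedBall (0 : Amb n) 1 \ {0} with hB
  have hBm : MeasurableSet B := measurableSet_closedBall.diff (measurableSet_singleton 0)
  have hB0 : ∀ y ∈ B, y ≠ 0 := fun y hy => hy.2
  set M : Amb n → Amb n := fun y => ‖y‖ • suppPt Ω y with hM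
  let M' : Amb n → Amb n →L[ℝ] Amb n := fun y =>
    ‖y‖ • fderiv ℝ (suppPt Ω) y + (‖y‖⁻¹ • innerSL ℝ y).smulRight (suppPt Ω y)
  have hMd : ∀ y ≠ 0, HasFDerivAt M (M' y) y := fun y hy =>
    (HasFDerivAt_norm hy).smul (hasFDerivAt_suppPt hsol.smooth hy)
  have hdet : ∀ y ≠ 0, (M' y).det = 1 := by
    intro y hy
    have hpos : 0 < ‖y‖ := norm_pos_iff.2 hy
    set x := sphNormalize y hy
    have hyx : y = ‖y‖ • (x : Amb n) := by
      simp only [x, sphNormalize]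
      rw [smul_smul, mul_inv_cancel₀ hpos.ne', one_smul]
    have h1 : M' y = fderiv ℝ (suppPt Ω) x + (innerSL ℝ (x : Amb n)).smulRight (suppPt Ω x) := by
      have h2 : fderiv ℝ (suppPt Ω) y = ‖y‖⁻¹ • fderiv ℝ (suppPt Ω) x := by
        conv_lhs => rw [hyx]
        exact fderiv_suppPt_smul hsol.smooth hpos (sph_ne_zero x)
      have h3 : suppPt Ω y = suppPt Ω x := by
        conv_lhs => rw [hyx]
        exact suppPt_smul hsol.smooth hpos (sph_ne_zero x)
      simp only [M']
      rw [h2, h3, smul_smul, mul_inv_cancel₀ hpos.ne', one_smul, ← map_smul]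
      rfl
    -- For p = X(x) the identity reads u · det = ⟨x, X(x)⟩ = u.
    have h2 := suppFn_mul_det_add hsol x (suppPt Ω x)
    rw [← h1, inner_suppPt hsol.smooth (sph_ne_zero x)] at h2
    exact (mul_eq_left₀ (suppFn_pos hsol (sph_ne_zero x)).ne').1 h2
  have hsurj : ∀ z ∈ Ω, z ≠ 0 → ∃ y ∈ B, M y = z := by
    intro z hz hz0
    have hcont : Continuous fun x : Sph n => (suppFn Ω x)⁻¹ * ⟪(x : Amb n), z⟫ :=
      (continuous_inv_suppFn_sph hsol).mul (by fun_prop)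
    have hne : (univ : Set (Sph n)).Nonempty := ⟨sphNormalize z hz0, mem_univ _⟩
    -- The maximum r of ⟨x, z⟩/u(x) is the gauge of z, so z/r is a boundary point and a maximising x
    -- is a normal there.
    obtain ⟨x, -, hx⟩ := isCompact_univ.exists_isMaxOn hne hcont.continuousOn
    have hux := suppFn_pos hsol (sph_ne_zero x)
    set r := (suppFn Ω x)⁻¹ * ⟪(x : Amb n), z⟫ with hr
    have hr1 : r ≤ 1 := by
      rw [hr, inv_mul_le_iff₀ hux, mul_one]
      exact inner_le_suppFn Ω _ hz
    have hr0 : 0 < r := by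
      refine lt_of_lt_of_le ?_ (hx (mem_univ (sphNormalize z hz0)))
      refine mul_pos (inv_pos.2 (suppFn_pos hsol (sph_ne_zero _))) ?_
      simp only [sphNormalize]
      rw [real_inner_smul_left]
      exact mul_pos (inv_pos.2 (norm_pos_iff.2 hz0)) (real_inner_self_pos.2 hz0)
    have hmem : r⁻¹ • z ∈ Ω := by
      refine mem_of_forall_inner_le_suppFn Ω fun x' => ?_
      have h1 := hx (mem_univ x')
      simp only [mem_ofPred_eq] at h1
      rw [← hr, inv_mul_le_iff₀ (suppFn_pos hsol (sph_ne_zero x'))] at h1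
      rw [inner_smul_right, inv_mul_le_iff₀ hr0, mul_comm]
      exact h1
    have heq : ⟪(x : Amb n), r⁻¹ • z⟫ = suppFn Ω x := by
      have h2 : ⟪(x : Amb n), z⟫ = suppFn Ω x * r := by
        rw [hr, mul_inv_cancel_left₀ hux.ne']
      rw [inner_smul_right, h2, mul_comm, mul_assoc, mul_inv_cancel₀ hr0.ne', mul_one]
    have hX := eq_suppPt hsol.smooth (sph_ne_zero x) hmem heq
    refine ⟨r • (x : Amb n), ⟨?_, ?_⟩, ?_⟩
    · simpa [norm_smul, abs_of_pos hr0] using hr1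
    · exact smul_ne_zero hr0.ne' (sph_ne_zero x)
    · simp only [hM]
      rw [suppPt_smul hsol.smooth hr0 (sph_ne_zero x), ← hX, norm_smul, norm_sph,
        Real.norm_of_nonneg hr0.le, mul_one, smul_smul, mul_inv_cancel₀ hr0.ne', one_smul]
  have hMm : Measurable M := by
    refine measurable_norm.smul ?_
    exact (InnerProductSpace.toDual ℝ (Amb n)).symm.continuous.measurable.comp
      (measurable_fderiv ℝ (suppFn Ω))
  -- Surjectivity and Jacobian 1 give one inequality of measures; equal finite total masses turn it
  -- into equality without any injectivity.
  have hle : volume.restrict (Ω : Set (Amb n)) ≤ (volume.restrict B).map M := by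
    refine Measure.le_iff.2 fun E hE => ?_
    rw [Measure.map_apply hMm hE, Measure.restrict_apply hE, Measure.restrict_apply (hMm hE)]
    have hS : MeasurableSet (M ⁻¹' E ∩ B) := (hMm hE).inter hBm
    have h1 : E ∩ (Ω : Set (Amb n)) ⊆ M '' (M ⁻¹' E ∩ B) ∪ {0} := by
      rintro z ⟨hzE, hz⟩
      by_cases hz0 : z = 0
      · exact .inr hz0
      · obtain ⟨y, hy, rfl⟩ := hsurj z hz hz0
        exact .inl ⟨y, ⟨hzE, hy⟩, rfl⟩
    calc volume (E ∩ (Ω : Set (Amb n))) ≤ volume (M '' (M ⁻¹' E ∩ B)) + volume {(0 : Amb n)} :=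
          (measure_mono h1).trans (measure_union_le _ _)
      _ = volume (M '' (M ⁻¹' E ∩ B)) := by simp
      _ ≤ ∫⁻ y in M ⁻¹' E ∩ B, ENNReal.ofReal |(M' y).det| :=
          addHaar_image_le_lintegral_abs_det_fderiv volume hS
            fun y hy => (hMd y (hB0 y hy.2)).hasFDerivWithinAt
      _ = ∫⁻ y in M ⁻¹' E ∩ B, 1 :=
          setLIntegral_congr_fun hS fun y hy => by simp [hdet y (hB0 y hy.2)]
      _ = volume (M ⁻¹' E ∩ B) := by simp
  have hBv : volume B = volume (closedBall (0 : Amb n) 1) :=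
    measure_sdiff_null (measure_singleton _)
  have : IsFiniteMeasure (volume.restrict (Ω : Set (Amb n))) :=
    ⟨by rw [Measure.restrict_apply_univ]; exact Ω.isCompact.measure_lt_top⟩
  have : IsFiniteMeasure (volume.restrict B) :=
    ⟨by rw [Measure.restrict_apply_univ, hBv]; exact measure_closedBall_lt_top⟩
  have heq := Measure.eq_of_le_of_measure_univ_eq hle (by
    rw [Measure.map_apply hMm .univ, preimage_univ, Measure.restrict_apply_univ,
      Measure.restrict_apply_univ, hBv, hvol])
  rw [heq, lintegral_map hf hMm]

end Soliton

/-- The radial integral in the volume formula for projective images. -/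
lemma lintegral_Ioc_projective (n : ℕ) {b : ℝ} (hb : b < 1) :
    ∫⁻ r in Ioc (0 : ℝ) 1, ENNReal.ofReal (r ^ n * (1 - r * b)⁻¹ ^ (n + 2)) =
      ENNReal.ofReal ((1 - b)⁻¹ ^ (n + 1) / (n + 1)) := by
  have hpos : ∀ r ∈ Icc (0 : ℝ) 1, 0 < 1 - r * b := by
    intro r hr
    rcases le_or_gt b 0 with h | h
    · nlinarith [hr.1]
    · nlinarith [hr.2]
  have hcont : ContinuousOn (fun r : ℝ => r ^ n * (1 - r * b)⁻¹ ^ (n + 2)) (Icc 0 1) :=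
    (continuous_pow n).continuousOn.mul
      (((by fun_prop : Continuous fun r : ℝ => 1 - r * b).continuousOn.inv₀
        fun r hr => (hpos r hr).ne').pow _)
  -- The integrand has the primitive (r/(1 - rb))^(n+1)/(n+1).
  have hder : ∀ r ∈ uIcc (0 : ℝ) 1, HasDerivAt
      (fun r : ℝ => (r * (1 - r * b)⁻¹) ^ (n + 1) / (n + 1))
      (r ^ n * (1 - r * b)⁻¹ ^ (n + 2)) r := by
    intro r hr
    rw [uIcc_of_le zero_le_one] at hr
    have h0 := (hpos r hr).ne'
    have h1 : HasDerivAt (fun r : ℝ => 1 - r * b) (-b) r := by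
      simpa using ((hasDerivAt_id r).mul_const b).const_sub 1
    have h2 := (((hasDerivAt_id r).mul (h1.inv h0)).pow (n + 1)).div_const ((n : ℝ) + 1)
    have h3 : r ^ n * (1 - r * b)⁻¹ ^ (n + 2) = ((n + 1 : ℕ) : ℝ) * (r * (1 - r * b)⁻¹) ^ n *
        (1 * (1 - r * b)⁻¹ + r * (-(-b) / (1 - r * b) ^ 2)) / ((n : ℝ) + 1) := by
      have : (n : ℝ) + 1 ≠ 0 := by positivity
      push_cast
      rw [mul_pow, pow_add]
      field_simp
      ring
    rw [h3]
    exact h2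
  have h1 := intervalIntegral.integral_eq_sub_of_hasDerivAt hder
    (hcont.intervalIntegrable_of_Icc zero_le_one)
  rw [← ofReal_integral_eq_lintegral_ofReal, ← intervalIntegral.integral_of_le zero_le_one, h1]
  · simp
  · exact hcont.integrableOn_Icc.mono_set Ioc_subset_Icc_self
  · filter_upwards [ae_restrict_mem measurableSet_Ioc] with r hr
    have := hpos r ⟨hr.1.le, hr.2⟩
    have := hr.1
    simp only [Pi.zero_apply]
    positivity

/-- The volume of the image of a set under a projective map. -/
lemma volume_projective_image {n : ℕ} {K : Set (Amb n)} (hK : MeasurableSet K) {w : Amb n}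
    (hw : ∀ z ∈ K, ⟪w, z⟫ < 1) :
    volume ((fun z => (1 - ⟪w, z⟫)⁻¹ • z) '' K) =
      ∫⁻ z in K, ENNReal.ofReal ((1 - ⟪w, z⟫)⁻¹ ^ (n + 2)) := by
  let T' : Amb n → Amb n →L[ℝ] Amb n := fun z => (1 - ⟪w, z⟫)⁻¹ • ContinuousLinearMap.id ℝ (Amb n) +
    (((1 - ⟪w, z⟫) ^ 2)⁻¹ • innerSL ℝ w).smulRight z
  have hpos : ∀ z ∈ K, 0 < 1 - ⟪w, z⟫ := fun z hz => sub_pos.2 (hw z hz)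
  have hT : ∀ z ∈ K, HasFDerivAt (fun z => (1 - ⟪w, z⟫)⁻¹ • z) (T' z) z := by
    intro z hz
    have h1 : HasFDerivAt (fun z => 1 - ⟪w, z⟫) (-innerSL ℝ w) z :=
      (innerSL ℝ w).hasFDerivAt.const_sub 1
    have h2 := (hasDerivAt_inv (hpos z hz).ne').comp_hasFDerivAt z h1
    have h3 := h2.smul (hasFDerivAt_id z)
    have h4 : -((1 - ⟪w, z⟫) ^ 2)⁻¹ • -innerSL ℝ w = ((1 - ⟪w, z⟫) ^ 2)⁻¹ • innerSL ℝ w := by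
      rw [neg_smul, smul_neg, neg_neg]
    rw [h4] at h3
    exact h3
  have hdet : ∀ z ∈ K, (T' z).det = (1 - ⟪w, z⟫)⁻¹ ^ (n + 2) := by
    intro z hz
    have h0 := (hpos z hz).ne'
    -- With s = 1/(1 - ⟨w,z⟩) the derivative is s(id + s⟨w,·⟩z), of determinant s^(n+1)(1 + s⟨w,z⟩)
    -- = s^(n+2).
    have h1 : ((T' z : Amb n →L[ℝ] Amb n) : Amb n →ₗ[ℝ] Amb n) = (1 - ⟪w, z⟫)⁻¹ •
        LinearMap.transvection (innerSL ℝ w : Amb n →ₗ[ℝ] ℝ) ((1 - ⟪w, z⟫)⁻¹ • z) := by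
      refine LinearMap.ext fun v => ?_
      simp only [T', LinearMap.smul_apply, LinearMap.transvection.apply]
      simp [smul_smul]
      congr 1
      rw [← inv_pow]
      ring
    rw [ContinuousLinearMap.det, h1, LinearMap.det_smul, LinearMap.transvection.det, finrank_amb]
    simp only [map_smul, ContinuousLinearMap.coe_coe, innerSL_apply_apply, smul_eq_mul]
    rw [pow_succ _ (n + 1)]
    congr 1
    field_simp
    ring
  have hinj : InjOn (fun z => (1 - ⟪w, z⟫)⁻¹ • z) K := by
    -- The inverse is the projective map with -w in place of w.
    have hinv : ∀ z ∈ K, (1 + ⟪w, (1 - ⟪w, z⟫)⁻¹ • z⟫)⁻¹ • (1 - ⟪w, z⟫)⁻¹ • z = z := by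
      intro z hz
      have h0 := (hpos z hz).ne'
      rw [inner_smul_right, smul_smul]
      have : (1 + (1 - ⟪w, z⟫)⁻¹ * ⟪w, z⟫)⁻¹ * (1 - ⟪w, z⟫)⁻¹ = 1 := by
        have h2 : 1 + (1 - ⟪w, z⟫)⁻¹ * ⟪w, z⟫ = (1 - ⟪w, z⟫)⁻¹ := by
          field_simp
          ring
        rw [h2, inv_inv, mul_inv_cancel₀ h0]
      rw [this, one_smul]
    intro z hz z' hz' h
    simp only at h
    rw [← hinv z hz, ← hinv z' hz', h]
  rw [← lintegral_abs_det_fderiv_eq_addHaar_image volume hK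
    (fun z hz => (hT z hz).hasFDerivWithinAt) hinj]
  refine setLIntegral_congr_fun hK fun z hz => ?_
  have := hpos z hz
  simp only [hdet z hz]
  rw [abs_of_pos (by positivity)]

section Soliton

variable {n : ℕ} {Ω : ConvexBody (Amb n)} (hsol : IsSoliton (supportFn Ω 0))
include hsol

lemma continuous_suppPt_sph : Continuous fun x : Sph n => suppPt Ω x :=
  (contDiffOn_suppPt hsol.smooth).continuousOn.comp_continuous continuous_subtype_val sph_ne_zero

lemma continuous_fderiv_suppPt_sph : Continuous fun x : Sph n => fderiv ℝ (suppPt Ω) x :=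
  (continuousOn_fderiv_suppPt hsol.smooth).comp_continuous continuous_subtype_val sph_ne_zero

/-- The cone map moves the integral of the Jacobian to polar coordinates on the unit ball; the
radial integration lowers the exponent from n + 2 to n + 1 and leaves a mean over the sphere. -/
lemma volume_projective_image_eq
    (hvol : volume (Ω : Set (Amb n)) = volume (closedBall (0 : Amb n) 1)) {w : Amb n}
    (hw : ∀ z ∈ Ω, ⟪w, z⟫ < 1) :
    volume ((fun z => (1 - ⟪w, z⟫)⁻¹ • z) '' (Ω : Set (Amb n))) =
      ENNReal.ofReal (((sphMeasure n).real univ)⁻¹ *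
        ∫ x : Sph n, (1 - ⟪w, suppPt Ω x⟫)⁻¹ ^ (n + 1) ∂(sphMeasure n)) *
      volume (Ω : Set (Amb n)) := by
  have hω := sphMeasure_real_univ_pos n
  have hpos : ∀ x : Sph n, 0 < 1 - ⟪w, suppPt Ω x⟫ := fun x =>
    sub_pos.2 (hw _ (suppPt_mem hsol.smooth (sph_ne_zero x)))
  have hcont : Continuous fun x : Sph n => (1 - ⟪w, suppPt Ω x⟫)⁻¹ ^ (n + 1) :=
    ((continuous_const.sub (continuous_const.inner (continuous_suppPt_sph hsol))).inv₀
      fun x => (hpos x).ne').pow _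
  have hmeas : Measurable fun z : Amb n => ENNReal.ofReal ((1 - ⟪w, z⟫)⁻¹ ^ (n + 2)) :=
    (((by fun_prop : Continuous fun z : Amb n => 1 - ⟪w, z⟫).measurable.inv).pow_const _).ennreal_ofReal
  have hMm : Measurable fun y : Amb n => ‖y‖ • suppPt Ω y :=
    measurable_norm.smul ((InnerProductSpace.toDual ℝ (Amb n)).symm.continuous.measurable.comp
      (measurable_fderiv ℝ (suppFn Ω)))
  have hBm : MeasurableSet (closedBall (0 : Amb n) 1 \ {0}) :=
    measurableSet_closedBall.diff (measurableSet_singleton 0)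
  rw [volume_projective_image Ω.isCompact.measurableSet hw,
    setLIntegral_eq_setLIntegral_ball hsol hvol hmeas, ← lintegral_indicator hBm,
    lintegral_polar (Measurable.indicator (f := fun y =>
      ENNReal.ofReal ((1 - ⟪w, ‖y‖ • suppPt Ω y⟫)⁻¹ ^ (n + 2))) (hmeas.comp hMm) hBm)]
  have hin : ∀ x : Sph n, (∫⁻ r in Ioi (0 : ℝ), ENNReal.ofReal (r ^ n) *
      (closedBall (0 : Amb n) 1 \ {0}).indicator (fun y =>
        ENNReal.ofReal ((1 - ⟪w, ‖y‖ • suppPt Ω y⟫)⁻¹ ^ (n + 2))) (r • (x : Amb n))) =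
      ENNReal.ofReal ((1 - ⟪w, suppPt Ω x⟫)⁻¹ ^ (n + 1) / (n + 1)) := by
    intro x
    rw [← lintegral_Ioc_projective n (hw _ (suppPt_mem hsol.smooth (sph_ne_zero x))),
      ← lintegral_indicator measurableSet_Ioi, ← lintegral_indicator measurableSet_Ioc]
    refine lintegral_congr fun r => ?_
    by_cases hr0 : 0 < r
    · rw [indicator_of_mem (mem_Ioi.2 hr0)]
      have hrx : r • (x : Amb n) ≠ 0 := smul_ne_zero hr0.ne' (sph_ne_zero x)
      have hnr : ‖r • (x : Amb n)‖ = r := by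
        rw [norm_smul, norm_sph, mul_one, Real.norm_of_nonneg hr0.le]
      by_cases hr1 : r ≤ 1
      · rw [indicator_of_mem (show r ∈ Ioc (0 : ℝ) 1 from ⟨hr0, hr1⟩), indicator_of_mem
          (show r • (x : Amb n) ∈ closedBall (0 : Amb n) 1 \ {0} from
            ⟨by rw [mem_closedBall_zero_iff, hnr]; exact hr1, hrx⟩), hnr,
          suppPt_smul hsol.smooth hr0 (sph_ne_zero x), inner_smul_right,
          ← ENNReal.ofReal_mul (pow_nonneg hr0.le n)]
      · rw [indicator_of_notMem (show r ∉ Ioc (0 : ℝ) 1 from fun h => hr1 h.2),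
          indicator_of_notMem (show r • (x : Amb n) ∉ closedBall (0 : Amb n) 1 \ {0} from
            fun h => hr1 (by simpa [hnr] using mem_closedBall_zero_iff.1 h.1)), mul_zero]
    · rw [indicator_of_notMem (show r ∉ Ioi (0 : ℝ) from hr0),
        indicator_of_notMem (show r ∉ Ioc (0 : ℝ) 1 from fun h => hr0 h.1)]
  refine (lintegral_congr hin).trans ?_
  have hD0 : 0 ≤ ∫ x : Sph n, (1 - ⟪w, suppPt Ω x⟫)⁻¹ ^ (n + 1) ∂(sphMeasure n) :=
    integral_nonneg fun x => by have := hpos x; positivity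
  rw [volume_eq_ofReal hvol, ← ENNReal.ofReal_mul (by positivity),
    ← ofReal_integral_eq_lintegral_ofReal (hcont.div_const _).integrable_sph
      (.of_forall fun x => by have := hpos x; simp only [Pi.zero_apply]; positivity)]
  congr 1
  rw [integral_div]
  field_simp

end Soliton

/-! ### Elementary inequalities -/

lemma le_of_hasDerivAt_nonneg {g g' : ℝ → ℝ} {δ : ℝ}
    (h : ∀ t ∈ Icc 0 δ, HasDerivAt g (g' t) t) (h' : ∀ t ∈ Icc 0 δ, 0 ≤ g' t) :
    ∀ t ∈ Icc 0 δ, g 0 ≤ g t := by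
  intro t ht
  refine monotoneOn_of_deriv_nonneg (convex_Icc 0 δ)
    (fun s hs => (h s hs).continuousAt.continuousWithinAt)
    (fun s hs => (h s (interior_subset hs)).differentiableAt.differentiableWithinAt)
    (fun s hs => ?_) ⟨le_rfl, ht.1.trans ht.2⟩ ht ht.1
  rw [(h s (interior_subset hs)).deriv]
  exact h' s (interior_subset hs)

lemma le_taylor_two {f f₁ f₂ : ℝ → ℝ} {δ c : ℝ} (h1 : ∀ t ∈ Icc 0 δ, HasDerivAt f (f₁ t) t)
    (h2 : ∀ t ∈ Icc 0 δ, HasDerivAt f₁ (f₂ t) t) (hc : ∀ t ∈ Icc 0 δ, f₂ t ≤ c) :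
    ∀ t ∈ Icc 0 δ, f t ≤ f 0 + t * f₁ 0 + t ^ 2 / 2 * c := by
  have h3 : ∀ t ∈ Icc 0 δ, f₁ t ≤ f₁ 0 + t * c := by
    intro t ht
    have := le_of_hasDerivAt_nonneg (g := fun t => f₁ 0 + t * c - f₁ t)
      (g' := fun t => c - f₂ t)
      (fun s hs => by
        have h3 := (((hasDerivAt_id s).mul_const c).const_add (f₁ 0)).sub (h2 s hs)
        rw [one_mul] at h3
        exact h3)
      (fun s hs => sub_nonneg.2 (hc s hs)) t ht
    simp at this
    linarith
  intro t ht
  have := le_of_hasDerivAt_nonneg (g := fun t => f 0 + t * f₁ 0 + t ^ 2 / 2 * c - f t)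
    (g' := fun t => f₁ 0 + t * c - f₁ t)
    (fun s hs => by
      have h4 : HasDerivAt (fun t : ℝ => t ^ 2 / 2 * c) (s * c) s := by
        have h5 := (((hasDerivAt_pow 2 s).div_const 2).mul_const c)
        have h6 : ((2 : ℕ) : ℝ) * s ^ (2 - 1) / 2 * c = s * c := by norm_num
        rw [h6] at h5
        exact h5
      have h5 := ((((hasDerivAt_id s).mul_const (f₁ 0)).const_add (f 0)).add h4).sub (h1 s hs)
      rw [one_mul] at h5
      exact h5)
    (fun s hs => sub_nonneg.2 (h3 s hs)) t ht
  simp at this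
  linarith

/-- Multiplying the cubic for N + 1 by 1 - b gives the cubic for N minus a non-negative multiple of
b⁴. The odd degree of the truncation makes this hold for negative b too. -/
lemma cubic_le_inv_pow (N : ℕ) {b : ℝ} (hb : b < 1) :
    1 + N * b + N * (N + 1) / 2 * b ^ 2 + N * (N + 1) * (N + 2) / 6 * b ^ 3 ≤
      (1 - b)⁻¹ ^ N := by
  have hpos : 0 < 1 - b := sub_pos.2 hb
  induction N with
  | zero => simp
  | succ N ih =>
    rw [pow_succ (1 - b)⁻¹ N, ← div_eq_mul_inv, le_div_iff₀ hpos]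
    refine le_trans ?_ ih
    have h1 : (0 : ℝ) ≤ N := N.cast_nonneg
    have h2 : 0 ≤ ((N : ℝ) + 1) * (N + 2) * (N + 3) / 6 * b ^ 4 := by positivity
    push_cast
    linarith [h2]

lemma exists_pow_expansion (N : ℕ) (m k : ℝ) : ∃ r : ℝ → ℝ, Continuous r ∧ ∀ ε,
    (1 + m * ε + k * ε ^ 2) ^ N =
      1 + N * m * ε + (N * k + N * (N - 1) / 2 * m ^ 2) * ε ^ 2 + ε ^ 3 * r ε := by
  induction N with
  | zero => exact ⟨fun _ => 0, continuous_const, fun ε => by simp⟩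
  | succ N ih =>
    obtain ⟨r, hr, h⟩ := ih
    refine ⟨fun ε => r ε * (1 + m * ε + k * ε ^ 2) + N * m * k +
      (N * k + N * (N - 1) / 2 * m ^ 2) * (m + k * ε), by fun_prop, fun ε => ?_⟩
    rw [pow_succ, h]
    push_cast
    ring

/-- The terms of order 0 and 1 agree on both sides, so one may divide by ε² and let ε tend to 0. -/
lemma coeff_le_of_forall_le_pow {N : ℕ} {m k A B ε₀ : ℝ} (hε₀ : 0 < ε₀)
    (h : ∀ ε, 0 < ε → ε < ε₀ →
      1 + N * m * ε + A * ε ^ 2 + B * ε ^ 3 ≤ (1 + m * ε + k * ε ^ 2) ^ N) :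
    A ≤ N * k + N * (N - 1) / 2 * m ^ 2 := by
  obtain ⟨r, hr, hexp⟩ := exists_pow_expansion N m k
  have h1 : ∀ᶠ ε in nhdsWithin (0 : ℝ) (Ioi 0),
      A + B * ε ≤ N * k + N * (N - 1) / 2 * m ^ 2 + ε * r ε := by
    filter_upwards [Ioo_mem_nhdsGT hε₀] with ε hε
    have h2 := h ε hε.1 hε.2
    rw [hexp] at h2
    have h3 : (A + B * ε) * ε ^ 2 ≤ (N * k + N * (N - 1) / 2 * m ^ 2 + ε * r ε) * ε ^ 2 := by
      linarith
    exact le_of_mul_le_mul_right h3 (pow_pos hε.1 2)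
  have h4 : Filter.Tendsto (fun ε : ℝ => A + B * ε) (nhdsWithin 0 (Ioi 0)) (nhds A) := by
    have : Continuous fun ε : ℝ => A + B * ε := by fun_prop
    simpa using (this.tendsto 0).mono_left nhdsWithin_le_nhds
  have h5 : Filter.Tendsto (fun ε : ℝ => N * k + N * (N - 1) / 2 * m ^ 2 + ε * r ε)
      (nhdsWithin 0 (Ioi 0)) (nhds (N * k + N * (N - 1) / 2 * m ^ 2)) := by
    have : Continuous fun ε : ℝ => N * k + N * (N - 1) / 2 * m ^ 2 + ε * r ε := by fun_prop
    simpa using (this.tendsto 0).mono_left nhdsWithin_le_nhds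
  exact le_of_tendsto_of_tendsto h4 h5 h1

lemma integral_sph_add {n : ℕ} {f g : Sph n → ℝ} (hf : Continuous f) (hg : Continuous g) :
    ∫ x, (f x + g x) ∂(sphMeasure n) = (∫ x, f x ∂(sphMeasure n)) + ∫ x, g x ∂(sphMeasure n) :=
  integral_add hf.integrable_sph hg.integrable_sph

/-! ### The local Brunn–Minkowski inequality from projective perturbations. -/

section Soliton

variable {n : ℕ} {Ω : ConvexBody (Amb n)} (hsol : IsSoliton (supportFn Ω 0))
include hsol

/-- Taylor's formula along x + τe, with first derivative ⟨X, e⟩ and second derivative ⟨DX e, e⟩;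
compactness of the sphere makes the error η uniform in x. -/
lemma exists_suppFn_le_taylor (e : Amb n) {η : ℝ} (hη : 0 < η) :
    ∃ δ > 0, ∀ x : Sph n, ∀ τ ∈ Icc 0 δ, suppFn Ω (x + τ • e) ≤ suppFn Ω x +
      τ * ⟪suppPt Ω x, e⟫ + τ ^ 2 / 2 * (⟪fderiv ℝ (suppPt Ω) x e, e⟫ + η) := by
  have hev : ∀ᶠ τ : ℝ in nhds 0, ∀ x ∈ (univ : Set (Sph n)), (x : Amb n) + τ • e ≠ 0 ∧
      ⟪fderiv ℝ (suppPt Ω) (x + τ • e) e, e⟫ < ⟪fderiv ℝ (suppPt Ω) x e, e⟫ + η := by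
    refine isCompact_univ.eventually_forall_of_forall_eventually fun x _ => ?_
    have h1 : ContinuousAt (fun z : ℝ × Sph n => (z.2 : Amb n) + z.1 • e) (0, x) := by fun_prop
    have h0 : ((0 : ℝ), x).2 + ((0 : ℝ), x).1 • e = (x : Amb n) := by simp
    have h2 : ContinuousAt (fun z : ℝ × Sph n =>
        ⟪fderiv ℝ (suppPt Ω) (z.2 + z.1 • e) e, e⟫) (0, x) := by
      have h3 : ContinuousAt (fderiv ℝ (suppPt Ω)) (((0 : ℝ), x).2 + ((0 : ℝ), x).1 • e) :=
        (continuousOn_fderiv_suppPt hsol.smooth).continuousAt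
          (isOpen_compl_singleton.mem_nhds (by rw [h0]; exact sph_ne_zero x))
      have h4 := ContinuousAt.comp (f := fun z : ℝ × Sph n => (z.2 : Amb n) + z.1 • e)
        (x := (0, x)) h3 h1
      exact (h4.clm_apply continuousAt_const).inner continuousAt_const
    have h5 : ContinuousAt (fun z : ℝ × Sph n => ⟪fderiv ℝ (suppPt Ω) z.2 e, e⟫ + η) (0, x) := by
      have h6 : Continuous fun z : ℝ × Sph n => fderiv ℝ (suppPt Ω) z.2 :=
        (continuous_fderiv_suppPt_sph hsol).comp continuous_snd
      exact (((h6.clm_apply continuous_const).inner continuous_const).add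
        continuous_const).continuousAt
    refine (h1.eventually_ne (by rw [h0]; exact sph_ne_zero x)).and (h2.eventually_lt h5 ?_)
    simp only [zero_smul, add_zero]
    linarith
  obtain ⟨δ, hδ, hev⟩ := Metric.eventually_nhds_iff.1 hev
  refine ⟨δ / 2, by positivity, fun x τ hτ => ?_⟩
  have hev' : ∀ t ∈ Icc 0 (δ / 2), (x : Amb n) + t • e ≠ 0 ∧
      ⟪fderiv ℝ (suppPt Ω) (x + t • e) e, e⟫ < ⟪fderiv ℝ (suppPt Ω) x e, e⟫ + η := fun t ht =>
    hev (by rw [Real.dist_eq, sub_zero, abs_of_nonneg ht.1]; linarith [ht.2]) x (mem_univ x)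
  have hline : ∀ t : ℝ, HasDerivAt (fun t : ℝ => (x : Amb n) + t • e) e t := fun t => by
    simpa using ((hasDerivAt_id t).smul_const e).const_add (x : Amb n)
  have key := le_taylor_two (f := fun t => suppFn Ω (x + t • e))
    (f₁ := fun t => ⟪suppPt Ω (x + t • e), e⟫)
    (f₂ := fun t => ⟪fderiv ℝ (suppPt Ω) (x + t • e) e, e⟫) (δ := δ / 2)
    (fun t ht => by
      exact (hasFDerivAt_suppFn hsol.smooth (hev' t ht).1).comp_hasDerivAt t (hline t))
    (fun t ht => by
      have h1 := (hasFDerivAt_suppPt hsol.smooth (hev' t ht).1).comp_hasDerivAt t (hline t)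
      simpa using h1.inner ℝ (hasDerivAt_const t e))
    (fun t ht => (hev' t ht).2.le) τ hτ
  simpa using key

/-- A second-order upper bound for the support function of a projective perturbation of `Ω`. -/
lemma exists_suppFn_add_le (e : Amb n) {η : ℝ} (hη : 0 < η) :
    ∃ ε₀ > 0, ∀ ε, 0 < ε → ε < ε₀ → ∀ x : Sph n, ∀ h : ℝ,
      h = suppFn Ω x + ε * (suppFn Ω x * ⟪suppPt Ω x, e⟫) + ε ^ 2 *
        (suppFn Ω x * ⟪suppPt Ω x, e⟫ ^ 2 +
          suppFn Ω x ^ 2 * ⟪fderiv ℝ (suppPt Ω) x e, e⟫ / 2 + η) →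
      0 ≤ h ∧ suppFn Ω (x + (ε * h) • e) ≤ h := by
  set u : Sph n → ℝ := fun x => suppFn Ω x with hu
  set p : Sph n → ℝ := fun x => ⟪suppPt Ω x, e⟫ with hp
  set d : Sph n → ℝ := fun x => ⟪fderiv ℝ (suppPt Ω) x e, e⟫ with hd
  set k : Sph n → ℝ := fun x => u x * p x ^ 2 + u x ^ 2 * d x / 2 + η with hk
  have huc : Continuous u := continuous_suppFn_sph hsol.smooth
  have hpc : Continuous p := (continuous_suppPt_sph hsol).inner continuous_const
  have hdc : Continuous d :=
    ((continuous_fderiv_suppPt_sph hsol).clm_apply continuous_const).inner continuous_const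
  have hkc : Continuous k := by fun_prop
  obtain ⟨R, hR⟩ := (isCompact_univ.image huc).bddAbove
  have hR' : ∀ x, u x ≤ R := fun x => hR (mem_image_of_mem u (mem_univ x))
  -- The Taylor error enters multiplied by h²/2, where h is close to u ≤ R, and must stay below η.
  set η' := η / (R ^ 2 + 1) with hη'
  have hη'0 : 0 < η' := by positivity
  obtain ⟨δ, hδ, htay⟩ := exists_suppFn_le_taylor hsol e hη'0
  -- H solves H = `suppFn Ω` (x + εH e) up to order ε², with the slack ε²η to absorb the remainder.
  let H : ℝ × Sph n → ℝ := fun z => u z.2 + z.1 * (u z.2 * p z.2) + z.1 ^ 2 * k z.2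
  have hHc : Continuous H := by fun_prop
  have hev : ∀ᶠ ε : ℝ in nhds 0, ∀ x ∈ (univ : Set (Sph n)), 0 < H (ε, x) ∧
      ε * H (ε, x) < δ ∧ H (ε, x) ^ 2 / 2 * η' + ε * (p x * k x) +
        (H (ε, x) ^ 2 - u x ^ 2) * d x / 2 < η := by
    refine isCompact_univ.eventually_forall_of_forall_eventually fun x _ => ?_
    have hH0 : H (0, x) = u x := by simp [H]
    have hux : 0 < u x := suppFn_pos hsol (sph_ne_zero x)
    refine .and (hHc.continuousAt.eventually (lt_mem_nhds (by rw [hH0]; exact hux))) (.and ?_ ?_)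
    · exact (by fun_prop : Continuous fun z : ℝ × Sph n => z.1 * H z).continuousAt.eventually
        (gt_mem_nhds (by simpa using hδ))
    · refine (by fun_prop : Continuous fun z : ℝ × Sph n => H z ^ 2 / 2 * η' +
        z.1 * (p z.2 * k z.2) + (H z ^ 2 - u z.2 ^ 2) * d z.2 / 2).continuousAt.eventually
        (gt_mem_nhds ?_)
      simp only [hH0, zero_mul, sub_self, zero_div, add_zero]
      rw [hη', ← mul_div_assoc, div_lt_iff₀ (by positivity)]
      have h1 : u x ^ 2 ≤ R ^ 2 := pow_le_pow_left₀ hux.le (hR' x) 2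
      nlinarith [sq_nonneg R]
  obtain ⟨ε₀, hε₀, hev⟩ := Metric.eventually_nhds_iff.1 hev
  refine ⟨ε₀, hε₀, fun ε hε hεε₀ x h hh => ?_⟩
  obtain ⟨h1, h2, h3⟩ := hev (y := ε) (by rwa [Real.dist_eq, sub_zero, abs_of_pos hε]) x
    (mem_univ x)
  have hhH : H (ε, x) = h := hh.symm
  rw [hhH] at h1 h2 h3
  refine ⟨h1.le, (htay x (ε * h) ⟨by positivity, h2.le⟩).trans ?_⟩
  have h4 : h - (u x + ε * h * p x + (ε * h) ^ 2 / 2 * (d x + η')) =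
      ε ^ 2 * (η - (h ^ 2 / 2 * η' + ε * (p x * k x) + (h ^ 2 - u x ^ 2) * d x / 2)) := by
    have h5 : h = u x + ε * (u x * p x) + ε ^ 2 * k x := hhH.symm
    have h6 : k x = u x * p x ^ 2 + u x ^ 2 * d x / 2 + η := rfl
    linear_combination (1 - ε * p x) * h5 + ε ^ 2 * h6
  have h7 : 0 ≤ ε ^ 2 * (η - (h ^ 2 / 2 * η' + ε * (p x * k x) + (h ^ 2 - u x ^ 2) * d x / 2)) :=
    mul_nonneg (by positivity) (by linarith)
  linarith

/-- The local Brunn–Minkowski inequality for the coordinates of the inverse Gauss map. -/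
theorem integral_inner_suppPt_sq_le
    (hvol : volume (Ω : Set (Amb n)) = volume (closedBall (0 : Amb n) 1)) (e : Amb n) :
    n * (∫ x : Sph n, ⟪suppPt Ω x, e⟫ ^ 2 ∂(sphMeasure n)) ≤
      (∫ x : Sph n, suppFn Ω x * ⟪fderiv ℝ (suppPt Ω) x e, e⟫ ∂(sphMeasure n)) +
      n * ((∫ x : Sph n, ⟪suppPt Ω x, e⟫ ∂(sphMeasure n)) ^ 2 / (sphMeasure n).real univ) := by
  set u : Sph n → ℝ := fun x => suppFn Ω x with hu
  set p : Sph n → ℝ := fun x => ⟪suppPt Ω x, e⟫ with hp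
  set d : Sph n → ℝ := fun x => ⟪fderiv ℝ (suppPt Ω) x e, e⟫ with hd
  set om := (sphMeasure n).real univ with hom
  have hom0 : 0 < om := sphMeasure_real_univ_pos n
  have huc : Continuous u := continuous_suppFn_sph hsol.smooth
  have hpc : Continuous p := (continuous_suppPt_sph hsol).inner continuous_const
  have hdc : Continuous d :=
    ((continuous_fderiv_suppPt_sph hsol).clm_apply continuous_const).inner continuous_const
  have hu0 : ∀ x, 0 < u x := fun x => suppFn_pos hsol (sph_ne_zero x)
  have huic : Continuous fun x => (u x)⁻¹ := continuous_inv_suppFn_sph hsol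
  set P1 := ∫ x, p x ∂(sphMeasure n) with hP1
  set P2 := ∫ x, p x ^ 2 ∂(sphMeasure n) with hP2
  set P3 := ∫ x, p x ^ 3 ∂(sphMeasure n) with hP3
  set Q := ∫ x, u x * d x ∂(sphMeasure n) with hQ
  set J := ∫ x, (u x)⁻¹ ∂(sphMeasure n) with hJ
  have hJ0 : 0 ≤ J := integral_nonneg fun x => (inv_pos.2 (hu0 x)).le
  have key : ∀ η > (0 : ℝ), (n + 1) * (n + 2) / 2 * (P2 / om) ≤
      (n + 1) * ((P2 + Q / 2 + η * J) / om) + (n + 1) * n / 2 * (P1 / om) ^ 2 := by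
    intro η hη
    obtain ⟨ε₀, hε₀, hsup⟩ := exists_suppFn_add_le hsol e hη
    obtain ⟨C, hC⟩ := (Ω.isCompact.image
      (by fun_prop : Continuous fun z : Amb n => ⟪e, z⟫)).bddAbove
    have hC' : ∀ z ∈ Ω, ⟪e, z⟫ ≤ |C| + 1 := fun z hz =>
      (hC (mem_image_of_mem (fun z : Amb n => ⟪e, z⟫) hz)).trans (by linarith [le_abs_self C])
    -- m and k come from integrating h/u, where the slack η contributes ηJ; A and B come from the
    -- cubic lower bound for the volume ratio.
    have hmain := coeff_le_of_forall_le_pow (N := n + 1) (m := P1 / om)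
      (k := (P2 + Q / 2 + η * J) / om)
      (A := (n + 1) * (n + 2) / 2 * (P2 / om)) (B := (n + 1) * (n + 2) * (n + 3) / 6 * (P3 / om))
      (ε₀ := min ε₀ (|C| + 1)⁻¹) (lt_min hε₀ (by positivity)) (by
        intro ε hε hεm
        have hεε₀ := hεm.trans_le (min_le_left _ _)
        have hεC := hεm.trans_le (min_le_right _ _)
        have hw : ∀ z ∈ Ω, ⟪ε • e, z⟫ < 1 := by
          intro z hz
          rw [real_inner_smul_left]
          calc ε * ⟪e, z⟫ ≤ ε * (|C| + 1) := mul_le_mul_of_nonneg_left (hC' z hz) hε.le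
            _ < (|C| + 1)⁻¹ * (|C| + 1) := mul_lt_mul_of_pos_right hεC (by positivity)
            _ = 1 := inv_mul_cancel₀ (by positivity)
        have hwp : ∀ x : Sph n, ε * p x < 1 := fun x => by
          have := hw _ (suppPt_mem hsol.smooth (sph_ne_zero x))
          rwa [real_inner_smul_left, real_inner_comm] at this
        set h : Sph n → ℝ := fun x => u x + ε * (u x * p x) +
          ε ^ 2 * (u x * p x ^ 2 + u x ^ 2 * d x / 2 + η) with hh
        have hhc : Continuous h := by fun_prop
        have hh0 : ∀ x, 0 ≤ h x := fun x => (hsup ε hε hεε₀ x (h x) rfl).1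
        -- The bound ⟨x, z⟩/(1 - ε⟨e,z⟩) ≤ h is equivalent to ⟨x + εh e, z⟩ ≤ h, which explains the
        -- implicit equation for h.
        have hL : ∀ z ∈ (fun z => (1 - ⟪ε • e, z⟫)⁻¹ • z) '' (Ω : Set (Amb n)), ∀ x : Sph n,
            ⟪(x : Amb n), z⟫ ≤ h x := by
          rintro _ ⟨z, hz, rfl⟩ x
          have h1 := (hsup ε hε hεε₀ x (h x) rfl).2
          have h2 := inner_le_suppFn Ω ((x : Amb n) + (ε * h x) • e) hz
          rw [inner_add_left, real_inner_smul_left] at h2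
          simp only [inner_smul_right]
          rw [inv_mul_le_iff₀ (sub_pos.2 (hw z hz)), real_inner_smul_left]
          linarith
        have hLc : IsCompact ((fun z => (1 - ⟪ε • e, z⟫)⁻¹ • z) '' (Ω : Set (Amb n))) := by
          refine Ω.isCompact.image_of_continuousOn (ContinuousOn.fun_smul ?_ continuousOn_id)
          exact (by fun_prop : Continuous fun z : Amb n => 1 - ⟪ε • e, z⟫).continuousOn.inv₀
            fun z hz => (sub_pos.2 (hw z hz)).ne'
        set D := om⁻¹ * ∫ x : Sph n, (1 - ⟪ε • e, suppPt Ω x⟫)⁻¹ ^ (n + 1) ∂(sphMeasure n) with hD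
        have hI : om⁻¹ * ∫ x : Sph n, (u x)⁻¹ * h x ∂(sphMeasure n) =
            1 + P1 / om * ε + (P2 + Q / 2 + η * J) / om * ε ^ 2 := by
          have h1 : ∀ x : Sph n, (u x)⁻¹ * h x = (1 + ε * p x) +
              ε ^ 2 * (p x ^ 2 + (u x * d x) / 2 + η * (u x)⁻¹) := fun x => by
            have := (hu0 x).ne'
            simp only [hh]
            field_simp
          simp_rw [h1]
          rw [integral_sph_add, integral_sph_add, integral_const_mul, integral_const_mul,
            integral_sph_add, integral_sph_add, integral_const_mul, integral_div, integral_const,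
            smul_eq_mul, mul_one]
          rotate_left
          iterate 8 fun_prop
          simp only [← hP1, ← hP2, ← hQ, ← hJ, ← hom]
          field_simp
        have hDle : D ≤ (1 + P1 / om * ε + (P2 + Q / 2 + η * J) / om * ε ^ 2) ^ (n + 1) := by
          rcases le_or_gt D 0 with hD0 | hD0
          · refine hD0.trans ?_
            rw [← hI]
            have : 0 ≤ ∫ x : Sph n, (u x)⁻¹ * h x ∂(sphMeasure n) :=
              integral_nonneg fun x => mul_nonneg (inv_pos.2 (hu0 x)).le (hh0 x)
            positivity
          · rw [← hI]
            exact le_integral_pow hsol hvol hLc hD0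
              (volume_projective_image_eq hsol hvol hw).ge hhc hh0 hL
        refine le_trans ?_ hDle
        have hlow : (∫ x, (1 + (n + 1) * (ε * p x) + (n + 1) * (n + 2) / 2 * (ε * p x) ^ 2 +
            (n + 1) * (n + 2) * (n + 3) / 6 * (ε * p x) ^ 3) ∂(sphMeasure n)) ≤
            ∫ x : Sph n, (1 - ⟪ε • e, suppPt Ω x⟫)⁻¹ ^ (n + 1) ∂(sphMeasure n) := by
          refine integral_mono (Continuous.integrable_sph (by fun_prop)) ?_ fun x => ?_
          · refine Continuous.integrable_sph (((continuous_const.sub (continuous_const.inner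
              (continuous_suppPt_sph hsol))).inv₀ fun x => ?_).pow _)
            exact (sub_pos.2 (hw _ (suppPt_mem hsol.smooth (sph_ne_zero x)))).ne'
          · have h1 := cubic_le_inv_pow (n + 1) (hwp x)
            simp only
            rw [real_inner_smul_left, real_inner_comm]
            refine le_trans (le_of_eq ?_) h1
            push_cast
            ring
        have hlowv : (∫ x, (1 + (n + 1) * (ε * p x) + (n + 1) * (n + 2) / 2 * (ε * p x) ^ 2 +
            (n + 1) * (n + 2) * (n + 3) / 6 * (ε * p x) ^ 3) ∂(sphMeasure n)) =
            om + (n + 1) * ε * P1 + (n + 1) * (n + 2) / 2 * ε ^ 2 * P2 +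
              (n + 1) * (n + 2) * (n + 3) / 6 * ε ^ 3 * P3 := by
          simp_rw [mul_pow, ← mul_assoc]
          rw [integral_sph_add, integral_sph_add, integral_sph_add, integral_const_mul,
            integral_const_mul, integral_const_mul, integral_const, smul_eq_mul, mul_one]
          iterate 6 fun_prop
        rw [hlowv] at hlow
        have h1 := mul_le_mul_of_nonneg_left hlow (inv_pos.2 hom0).le
        refine le_trans (le_of_eq ?_) h1
        push_cast
        field_simp)
    push_cast at hmain
    simpa using hmain
  -- Subtracting (n+1)P2/ω from both sides leaves n/2 out of the coefficient (n+2)/2 of P2.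
  have key2 : ∀ η > (0 : ℝ), n * P2 ≤ Q + n * (P1 ^ 2 / om) + 2 * η * J := by
    intro η hη
    have h1 := key η hη
    have hn : (0 : ℝ) < n + 1 := by positivity
    have h2 : (n + 1 : ℝ) / (2 * om) * (n * P2) ≤
        (n + 1) / (2 * om) * (Q + n * (P1 ^ 2 / om) + 2 * η * J) := by
      have e1 : (n + 1 : ℝ) * (n + 2) / 2 * (P2 / om) =
        (n + 1) / (2 * om) * (n * P2) + (n + 1) / om * P2 := by field_simp
      have e2 : (n + 1 : ℝ) * ((P2 + Q / 2 + η * J) / om) + (n + 1) * n / 2 * (P1 / om) ^ 2 =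
        (n + 1) / (2 * om) * (Q + n * (P1 ^ 2 / om) + 2 * η * J) + (n + 1) / om * P2 := by
        field_simp; ring
      rw [e1, e2] at h1
      linarith
    exact le_of_mul_le_mul_left h2 (by positivity)
  refine le_of_forall_pos_le_add fun δ hδ => ?_
  refine (key2 (δ / (2 * (J + 1))) (by positivity)).trans ?_
  gcongr
  have : 2 * (δ / (2 * (J + 1))) * J = δ * (J / (J + 1)) := by field_simp
  rw [this]
  have : J / (J + 1) ≤ 1 := by rw [div_le_one (by positivity)]; linarith
  nlinarith

end Soliton

/-! ### Rigidity: the soliton is the unit ball. -/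

lemma suppFn_apply_zero {n : ℕ} (Ω : ConvexBody (Amb n)) : suppFn Ω 0 = 0 := by
  have h := suppFn_smul Ω (r := 2) two_pos 0
  rw [smul_zero, smul_eq_mul] at h
  linarith

lemma integral_sph_sub {n : ℕ} {f g : Sph n → ℝ} (hf : Continuous f) (hg : Continuous g) :
    ∫ x, (f x - g x) ∂(sphMeasure n) = (∫ x, f x ∂(sphMeasure n)) - ∫ x, g x ∂(sphMeasure n) :=
  integral_sub hf.integrable_sph hg.integrable_sph

/-- The divergence theorem for the norm says that the integral equals n + 1 times itself; for n = 0
this would be void. -/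
lemma integral_sph_inner {n : ℕ} (hn : 1 ≤ n) (e : Amb n) :
    ∫ x : Sph n, ⟪(x : Amb n), e⟫ ∂(sphMeasure n) = 0 := by
  have h := integral_sph_fderiv (F := fun y : Amb n => ‖y‖)
    (fun y hy => (contDiffAt_norm ℝ hy).contDiffWithinAt)
    (fun r hr y => by rw [norm_smul, Real.norm_of_nonneg hr.le, smul_eq_mul]) e
  have h1 : ∀ x : Sph n, fderiv ℝ (fun y : Amb n => ‖y‖) x e = ⟪(x : Amb n), e⟫ := fun x => by
    rw [(HasFDerivAt_norm (sph_ne_zero x)).fderiv, norm_sph]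
    simp
  simp_rw [h1, norm_sph, mul_one] at h
  have hn' : (1 : ℝ) ≤ n := by exact_mod_cast hn
  nlinarith

section Soliton

variable {n : ℕ} {Ω : ConvexBody (Amb n)} (hsol : IsSoliton (supportFn Ω 0))
include hsol

/-- The divergence theorem for `suppFn Ω`, whose gradient is X. -/
lemma integral_inner_suppPt (e : Amb n) :
    ∫ x : Sph n, ⟪suppPt Ω x, e⟫ ∂(sphMeasure n) =
      (n + 1) * ∫ x : Sph n, ⟪(x : Amb n), e⟫ * suppFn Ω x ∂(sphMeasure n) := by
  rw [← integral_sph_fderiv ((contDiffOn_suppFn hsol.smooth).of_le (by simp))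
    (fun r hr y => suppFn_smul Ω hr y)]
  refine integral_congr_ae (ae_of_all _ fun x => ?_)
  simp only
  rw [(hasFDerivAt_suppFn hsol.smooth (sph_ne_zero x)).fderiv, innerSL_apply_apply]

/-- The divergence theorem for the 1-homogeneous function `suppFn Ω y` ⟨X(y), e⟩; this eliminates DX
from the local inequality. -/
lemma integral_inner_suppPt_sq_add (e : Amb n) :
    (∫ x : Sph n, ⟪suppPt Ω x, e⟫ ^ 2 ∂(sphMeasure n)) +
        ∫ x : Sph n, suppFn Ω x * ⟪fderiv ℝ (suppPt Ω) x e, e⟫ ∂(sphMeasure n) =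
      (n + 1) * ∫ x : Sph n, ⟪(x : Amb n), e⟫ * (suppFn Ω x * ⟪suppPt Ω x, e⟫)
        ∂(sphMeasure n) := by
  have hXc := continuous_suppPt_sph hsol
  have huc := continuous_suppFn_sph hsol.smooth
  have hDc := (continuous_fderiv_suppPt_sph hsol).clm_apply (continuous_const (y := e))
  have hsmul : ∀ r > (0 : ℝ), ∀ y, suppFn Ω (r • y) * ⟪suppPt Ω (r • y), e⟫ =
      r • (suppFn Ω y * ⟪suppPt Ω y, e⟫) := by
    intro r hr y
    rcases eq_or_ne y 0 with rfl | hy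
    · simp [suppFn_apply_zero]
    · rw [suppFn_smul Ω hr, suppPt_smul hsol.smooth hr hy, smul_eq_mul, smul_eq_mul, mul_assoc]
  have hdiff : ContDiffOn ℝ 1 (fun y => suppFn Ω y * ⟪suppPt Ω y, e⟫) {0}ᶜ :=
    ((contDiffOn_suppFn hsol.smooth).mul
      ((contDiffOn_suppPt hsol.smooth).inner ℝ contDiffOn_const)).of_le (by simp)
  rw [← integral_sph_fderiv hdiff hsmul e, ← integral_sph_add (by fun_prop) (by fun_prop)]
  refine integral_congr_ae (ae_of_all _ fun x => ?_)
  have h1 := (hasFDerivAt_suppFn hsol.smooth (sph_ne_zero x)).mul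
    ((hasFDerivAt_suppPt hsol.smooth (sph_ne_zero x)).inner ℝ (hasFDerivAt_const e (x : Amb n)))
  have h2 : fderiv ℝ (fun y => suppFn Ω y * ⟪suppPt Ω y, e⟫) (x : Amb n) = _ := h1.fderiv
  simp only
  rw [h2]
  simp [real_inner_comm]
  ring

/-- The support points of a soliton of the volume of the unit ball lie on a round sphere. -/
theorem exists_suppPt_sub_eq
    (hvol : volume (Ω : Set (Amb n)) = volume (closedBall (0 : Amb n) 1)) :
    ∃ a : Amb n, ∀ x : Sph n,
      suppPt Ω x - a = (suppFn Ω x - ⟪(x : Amb n), a⟫) • (x : Amb n) := by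
  set om := (sphMeasure n).real univ with hom
  have hom0 : 0 < om := sphMeasure_real_univ_pos n
  have hXc := continuous_suppPt_sph hsol
  have huc := continuous_suppFn_sph hsol.smooth
  have hXi : Integrable (fun x : Sph n => suppPt Ω x) (sphMeasure n) := by
    have : CompactSpace (Sph n) := compactSpace_sph n
    exact hXc.integrable_of_hasCompactSupport (HasCompactSupport.of_compactSpace _)
  set a : Amb n := om⁻¹ • ∫ x : Sph n, suppPt Ω x ∂(sphMeasure n) with ha
  have hXe : ∀ e : Amb n, ∫ x : Sph n, ⟪suppPt Ω x, e⟫ ∂(sphMeasure n) = om * ⟪a, e⟫ := by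
    intro e
    simp_rw [real_inner_comm e]
    rw [integral_inner hXi, ha, real_inner_smul_right]
    field_simp
  have hn : (0 : ℝ) < n + 1 := by positivity
  have h1 : ∀ e : Amb n, ∫ x : Sph n, ⟪suppPt Ω x, e⟫ ^ 2 ∂(sphMeasure n) ≤
      (∫ x : Sph n, suppFn Ω x * (⟪(x : Amb n), e⟫ * ⟪e, suppPt Ω x⟫) ∂(sphMeasure n)) +
        n * om / (n + 1) * (⟪a, e⟫ * ⟪e, a⟫) := by
    intro e
    have e1 := integral_inner_suppPt_sq_le hsol hvol e
    have e2 := integral_inner_suppPt_sq_add hsol e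
    rw [hXe] at e1
    have e3 : ∀ x : Sph n, suppFn Ω x * (⟪(x : Amb n), e⟫ * ⟪e, suppPt Ω x⟫) =
      ⟪(x : Amb n), e⟫ * (suppFn Ω x * ⟪suppPt Ω x, e⟫) := fun x => by
      rw [real_inner_comm e (suppPt Ω x)]; ring
    simp_rw [e3]
    have e4 : n * ((om * ⟪a, e⟫) ^ 2 / om) = n * om * (⟪a, e⟫ * ⟪e, a⟫) := by
      rw [real_inner_comm a e]; field_simp
    rw [← hom, e4] at e1
    refine le_of_mul_le_mul_left ?_ hn
    rw [mul_add, ← e2]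
    have e5 : (n + 1 : ℝ) * (n * om / (n + 1) * (⟪a, e⟫ * ⟪e, a⟫)) =
      n * om * (⟪a, e⟫ * ⟪e, a⟫) := by field_simp
    rw [e5]
    linarith
  let b := EuclideanSpace.basisFun (Fin (n + 1)) ℝ
  -- Summing over an orthonormal basis and using ⟨x, X(x)⟩ = u(x) turns the mixed term into u².
  have h2 : ∫ x : Sph n, ‖suppPt Ω x‖ ^ 2 ∂(sphMeasure n) ≤
      (∫ x : Sph n, suppFn Ω x ^ 2 ∂(sphMeasure n)) + n * om / (n + 1) * ‖a‖ ^ 2 := by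
    have h3 := Finset.sum_le_sum fun i (_ : i ∈ Finset.univ) => h1 (b i)
    rw [Finset.sum_add_distrib, ← Finset.mul_sum, b.sum_inner_mul_inner,
      ← integral_finsetSum _ fun i _ => Continuous.integrable_sph (by fun_prop),
      ← integral_finsetSum _ fun i _ => Continuous.integrable_sph (by fun_prop)] at h3
    simp_rw [← Finset.mul_sum, b.sum_inner_mul_inner, inner_suppPt hsol.smooth (sph_ne_zero _),
      ← pow_two, real_inner_self_eq_norm_sq] at h3
    refine le_trans (le_of_eq (integral_congr_ae (ae_of_all _ fun x => ?_))) h3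
    simp only
    rw [← real_inner_self_eq_norm_sq, ← b.sum_inner_mul_inner]
    exact Finset.sum_congr rfl fun i _ => by rw [pow_two, real_inner_comm (b i)]
  refine ⟨a, ?_⟩
  have h4 : ∀ x : Sph n, ‖suppPt Ω x - a - (suppFn Ω x - ⟪(x : Amb n), a⟫) • (x : Amb n)‖ ^ 2 =
      ‖suppPt Ω x‖ ^ 2 - suppFn Ω x ^ 2 - 2 * ⟪suppPt Ω x, a⟫ + 2 * (⟪(x : Amb n), a⟫ * suppFn Ω x)
        - ⟪(x : Amb n), a⟫ * ⟪(x : Amb n), a⟫ + ‖a‖ ^ 2 := by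
    intro x
    have h5 : ⟪suppPt Ω x - a, (x : Amb n)⟫ = suppFn Ω x - ⟪(x : Amb n), a⟫ := by
      rw [inner_sub_left, real_inner_comm, inner_suppPt hsol.smooth (sph_ne_zero x),
        real_inner_comm]
    rw [norm_sub_sq_real, real_inner_smul_right, h5, norm_smul, norm_sph, norm_sub_sq_real, mul_one,
      Real.norm_eq_abs, sq_abs]
    ring
  -- The integrand is the squared tangential part of X - a. After `h2` the coefficients of ω|a|² are
  -- n/(n+1), -2, 2/(n+1), -1/(n+1) and 1, with sum zero.
  have h5 : ∫ x : Sph n, ‖suppPt Ω x - a - (suppFn Ω x - ⟪(x : Amb n), a⟫) • (x : Amb n)‖ ^ 2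
      ∂(sphMeasure n) ≤ 0 := by
    simp_rw [h4]
    rw [integral_sph_add (by fun_prop) (by fun_prop), integral_sph_sub (by fun_prop) (by fun_prop),
      integral_sph_add (by fun_prop) (by fun_prop), integral_sph_sub (by fun_prop) (by fun_prop),
      integral_sph_sub (by fun_prop) (by fun_prop), integral_const_mul, integral_const_mul, hXe,
      integral_const, smul_eq_mul, ← hom]
    have e1 := integral_inner_suppPt hsol a
    rw [hXe] at e1
    have e2 := integral_sph_inner_mul_inner a a
    rw [← hom, real_inner_self_eq_norm_sq] at e2
    rw [real_inner_self_eq_norm_sq] at e1 ⊢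
    have e3 : n * om / (n + 1) * ‖a‖ ^ 2 = om * ‖a‖ ^ 2 - (om * ‖a‖ ^ 2) / (n + 1) := by
      field_simp; ring
    rw [eq_comm] at e1
    rw [mul_comm, ← eq_div_iff hn.ne'] at e1 e2
    rw [e1, e2]
    rw [e3] at h2
    linarith
  have hc : Continuous fun x : Sph n =>
    ‖suppPt Ω x - a - (suppFn Ω x - ⟪(x : Amb n), a⟫) • (x : Amb n)‖ ^ 2 := by fun_prop
  have h6 := (integral_eq_zero_iff_of_nonneg (fun x => by positivity) hc.integrable_sph).1
    (h5.antisymm (integral_nonneg fun x => by positivity))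
  have h7 := (hc.ae_eq_iff_eq (sphMeasure n) continuous_const).1 h6
  intro x
  have h8 := congrFun h7 x
  exact sub_eq_zero.1 (norm_eq_zero.1 (pow_eq_zero_iff two_ne_zero |>.1 h8))

end Soliton

section Soliton

variable {n : ℕ} {Ω : ConvexBody (Amb n)} (hsol : IsSoliton (supportFn Ω 0))
include hsol

/-- Since X - a is radial, (`suppFn Ω y` - ⟨a,y⟩)/‖y‖ has zero derivative off the origin, and the
punctured space is connected because its dimension n + 1 is at least 2. -/
lemma exists_suppFn_eq (hn : 1 ≤ n) {a : Amb n}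
    (ha : ∀ x : Sph n, suppPt Ω x - a = (suppFn Ω x - ⟪(x : Amb n), a⟫) • (x : Amb n)) :
    ∃ c : ℝ, ∀ y : Amb n, y ≠ 0 → suppFn Ω y = ⟪a, y⟫ + c * ‖y‖ := by
  have ha' : ∀ y : Amb n, y ≠ 0 →
      suppPt Ω y - a = ((suppFn Ω y - ⟪a, y⟫) / ‖y‖ ^ 2) • y := by
    intro y hy
    have hy' : 0 < ‖y‖ := norm_pos_iff.2 hy
    have h := ha (sphNormalize y hy)
    simp only [sphNormalize] at h
    rw [suppPt_smul hsol.smooth (inv_pos.2 hy') hy, suppFn_smul Ω (inv_pos.2 hy'),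
      real_inner_smul_left, smul_smul, real_inner_comm] at h
    rw [h, smul_eq_mul]
    congr 1
    field_simp
  have hder : ∀ y : Amb n, y ≠ 0 →
      HasFDerivAt (fun y => (suppFn Ω y - ⟪a, y⟫) * ‖y‖⁻¹) (0 : Amb n →L[ℝ] ℝ) y := by
    intro y hy
    have hy' : 0 < ‖y‖ := norm_pos_iff.2 hy
    have h1 : HasFDerivAt (fun y => suppFn Ω y - ⟪a, y⟫)
        (innerSL ℝ (suppPt Ω y) - innerSL ℝ a) y :=
      (hasFDerivAt_suppFn hsol.smooth hy).sub (innerSL ℝ a).hasFDerivAt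
    have h2 : HasFDerivAt (fun y : Amb n => ‖y‖⁻¹) (-(‖y‖ ^ 2)⁻¹ • (‖y‖⁻¹ • innerSL ℝ y)) y :=
      (hasDerivAt_inv hy'.ne').comp_hasFDerivAt y (HasFDerivAt_norm hy)
    have h3 := h1.mul h2
    have h4 : (suppFn Ω y - ⟪a, y⟫) • (-(‖y‖ ^ 2)⁻¹ • (‖y‖⁻¹ • innerSL ℝ y)) +
        ‖y‖⁻¹ • (innerSL ℝ (suppPt Ω y) - innerSL ℝ a) = 0 := by
      rw [← map_sub, ha' y hy]
      ext v
      simp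
      field_simp
      ring
    rw [h4] at h3
    exact h3
  obtain ⟨c, hc⟩ := (isOpen_compl_singleton (x := (0 : Amb n))).exists_is_const_of_fderiv_eq_zero
    (isConnected_compl_singleton_of_one_lt_rank
      (Module.one_lt_rank_of_one_lt_finrank (by rw [finrank_amb]; omega)) 0).isPreconnected
    (fun y hy => (hder y hy).differentiableAt.differentiableWithinAt)
    (fun y hy => (hder y hy).fderiv)
  refine ⟨c, fun y hy => ?_⟩
  have h := hc y hy
  have hy' : ‖y‖ ≠ 0 := norm_ne_zero_iff.2 hy
  rw [← div_eq_mul_inv, div_eq_iff hy'] at h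
  linarith

/-- The unit ball is the only soliton of its volume. -/
theorem eq_closedBall_of_isSoliton (hn : 1 ≤ n)
    (hvol : volume (Ω : Set (Amb n)) = volume (closedBall (0 : Amb n) 1)) :
    (Ω : Set (Amb n)) = closedBall 0 1 := by
  obtain ⟨a, ha⟩ := exists_suppPt_sub_eq hsol hvol
  obtain ⟨c, hc⟩ := exists_suppFn_eq hsol hn ha
  have hball : (Ω : Set (Amb n)) = closedBall a c := by
    ext z
    rw [mem_closedBall, dist_eq_norm]
    constructor
    · intro hz
      by_contra! hlt
      have hle : ∀ y : Amb n, y ≠ 0 → ⟪y, z - a⟫ ≤ c * ‖y‖ := fun y hy => by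
        have h1 := inner_le_suppFn Ω y hz
        rw [hc y hy] at h1
        rw [inner_sub_right, real_inner_comm a y]
        linarith
      rcases eq_or_ne (z - a) 0 with h0 | h0
      · obtain ⟨x⟩ : Nonempty (Sph n) :=
          (NormedSpace.sphere_nonempty.2 zero_le_one).to_subtype
        have h1 := hle x (sph_ne_zero x)
        rw [h0, inner_zero_right, norm_sph] at h1
        rw [h0, norm_zero] at hlt
        linarith
      · have h1 := hle _ h0
        rw [real_inner_self_eq_norm_sq] at h1
        nlinarith [norm_pos_iff.2 h0]
    · intro hz
      refine mem_of_forall_inner_le_suppFn Ω fun x => ?_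
      rw [hc x (sph_ne_zero x), norm_sph]
      have h1 := real_inner_le_norm (x : Amb n) (z - a)
      rw [norm_sph, inner_sub_right, real_inner_comm a] at h1
      linarith
  have hc1 : c = 1 := by
    have hc0 : 0 ≤ c := nonempty_closedBall.1 (hball ▸ Ω.nonempty)
    rw [hball, Measure.addHaar_closedBall _ _ hc0, Measure.addHaar_closedBall _ _ zero_le_one,
      ENNReal.mul_left_inj (measure_ball_pos _ _ one_pos).ne' measure_ball_lt_top.ne,
      finrank_amb, one_pow, ENNReal.ofReal_eq_ofReal_iff (by positivity) zero_le_one] at hvol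
    exact (pow_eq_one_iff_of_nonneg hc0 (by omega)).1 hvol
  subst hc1
  -- The volume fixes only the radius. For a unit ball with any centre A_u is the identity, so the
  -- soliton equation forces u = 1 and thereby fixes the centre.
  have hu1 : ∀ x : Sph n, suppFn Ω x = 1 := by
    intro x
    have hX : ∀ y : Amb n, y ≠ 0 → suppPt Ω y = a + ‖y‖⁻¹ • y := by
      intro y hy
      have hy' : 0 < ‖y‖ := norm_pos_iff.2 hy
      have h := ha (sphNormalize y hy)
      simp only [sphNormalize] at h
      rw [suppPt_smul hsol.smooth (inv_pos.2 hy') hy, suppFn_smul Ω (inv_pos.2 hy'), hc y hy,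
        real_inner_smul_left, real_inner_comm] at h
      rw [← sub_eq_iff_eq_add', h, smul_smul, smul_eq_mul]
      congr 1
      field_simp
      ring
    have hD : fderiv ℝ (suppPt Ω) x + (innerSL ℝ (x : Amb n)).smulRight (x : Amb n) =
        ContinuousLinearMap.id ℝ (Amb n) := by
      have h2 : HasFDerivAt (fun y : Amb n => ‖y‖⁻¹)
          (-(‖(x : Amb n)‖ ^ 2)⁻¹ • (‖(x : Amb n)‖⁻¹ • innerSL ℝ (x : Amb n))) (x : Amb n) :=
        (hasDerivAt_inv (norm_ne_zero_iff.2 (sph_ne_zero x))).comp_hasFDerivAt (x : Amb n)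
          (HasFDerivAt_norm (sph_ne_zero x))
      have h3 := (h2.smul (hasFDerivAt_id (x : Amb n))).const_add a
      have h4 := h3.congr_of_eventuallyEq
        (Filter.eventually_of_mem (isOpen_compl_singleton.mem_nhds (sph_ne_zero x)) hX)
      rw [h4.fderiv]
      ext1 v
      simp
    have h := suppFn_mul_det_add hsol x (x : Amb n)
    rw [hD, inner_self_sph] at h
    simpa [ContinuousLinearMap.det] using h
  have ha0 : a = 0 := by
    by_contra h0
    have h1 := hu1 (sphNormalize a h0)
    rw [hc _ (sph_ne_zero _), norm_sph] at h1
    simp only [sphNormalize, real_inner_smul_right, real_inner_self_eq_norm_sq] at h1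
    have h2 : 0 < ‖a‖ := norm_pos_iff.2 h0
    have h3 : 0 < ‖a‖⁻¹ * ‖a‖ ^ 2 := by positivity
    linarith
  rw [hball, ha0]

end Soliton

/-! ### Entropy point and polar body of the unit ball. -/

section Ball

variable {n : ℕ} {Ω : ConvexBody (Amb n)} (hΩ : (Ω : Set (Amb n)) = closedBall 0 1)
include hΩ

lemma supportFn_of_eq_closedBall (z : Amb n) (x : Sph n) :
    supportFn Ω z x = 1 - ⟪(x : Amb n), z⟫ := by
  refine IsGreatest.csSup_eq ⟨⟨x, ?_, ?_⟩, ?_⟩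
  · rw [hΩ, mem_closedBall_zero_iff, norm_sph]
  · simp only [inner_sub_right, inner_self_sph]
  · rintro _ ⟨y, hy, rfl⟩
    rw [hΩ, mem_closedBall_zero_iff] at hy
    have h1 := real_inner_le_norm (x : Amb n) y
    rw [norm_sph, one_mul] at h1
    simp only [inner_sub_right]
    linarith

lemma meanLogSupport_zero_of_eq_closedBall : meanLogSupport Ω 0 = 0 := by
  simp [meanLogSupport, supportFn_of_eq_closedBall hΩ]

/-- Linear functions integrate to zero, so u_z has mean 1. The integrand on the left is non-negative
where u_z > 0, because log t ≤ t - 1; this gives both the maximality of the origin and the equality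
case. -/
lemma integral_log_supportFn_eq (hn : 1 ≤ n) {z : Amb n}
    (hi : Integrable (fun x => Real.log (supportFn Ω z x)) (sphMeasure n)) :
    ∫ x : Sph n, (supportFn Ω z x - 1 - Real.log (supportFn Ω z x)) ∂(sphMeasure n) =
      -∫ x, Real.log (supportFn Ω z x) ∂(sphMeasure n) := by
  simp_rw [supportFn_of_eq_closedBall hΩ] at hi ⊢
  rw [integral_sub (Continuous.integrable_sph (by fun_prop)) hi]
  have h1 : ∀ x : Sph n, 1 - ⟪(x : Amb n), z⟫ - 1 = -⟪(x : Amb n), z⟫ := fun x => by ring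
  simp_rw [h1]
  rw [integral_neg, integral_sph_inner hn, neg_zero, zero_sub]

lemma isEntropyPoint_zero_of_eq_closedBall (hn : 1 ≤ n) : IsEntropyPoint Ω 0 := by
  have h0 : (0 : Amb n) ∈ Ω := by
    rw [← SetLike.mem_coe, hΩ]
    exact mem_closedBall_self zero_le_one
  have h1 : ∀ x : Sph n, supportFn Ω 0 x = 1 := fun x => by
    simp [supportFn_of_eq_closedBall hΩ]
  refine ⟨h0, ae_of_all _ fun x => by rw [h1]; exact one_pos, by simp [h1], ?_⟩
  refine IsGreatest.isLUB ⟨⟨0, h0, fun x => by rw [h1]; exact one_pos, rfl⟩, ?_⟩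
  rintro _ ⟨z, -, hpos, rfl⟩
  rw [meanLogSupport_zero_of_eq_closedBall hΩ, meanLogSupport, average_eq]
  refine smul_nonpos_of_nonneg_of_nonpos (by positivity) ?_
  by_cases hi : Integrable (fun x => Real.log (supportFn Ω z x)) (sphMeasure n)
  · have h2 := integral_log_supportFn_eq hΩ hn hi
    have h3 : 0 ≤ ∫ x : Sph n, (supportFn Ω z x - 1 - Real.log (supportFn Ω z x))
        ∂(sphMeasure n) :=
      integral_nonneg fun x => sub_nonneg.2 (Real.log_le_sub_one_of_pos (hpos x))
    linarith
  -- A non-integrable function has integral 0 by convention, which respects the bound.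
  · rw [integral_undef hi]

lemma IsEntropyPoint.eq_zero_of_eq_closedBall (hn : 1 ≤ n) {z : Amb n}
    (hz : IsEntropyPoint Ω z) : z = 0 := by
  have h1 := hz.isLUB.unique (isEntropyPoint_zero_of_eq_closedBall hΩ hn).isLUB
  have hom := sphMeasure_real_univ_pos n
  rw [meanLogSupport_zero_of_eq_closedBall hΩ, meanLogSupport, average_eq, smul_eq_zero_iff_right
    (inv_pos.2 hom).ne'] at h1
  have h2 := integral_log_supportFn_eq hΩ hn hz.integrable
  rw [h1, neg_zero] at h2
  have hi : Integrable (fun x : Sph n => supportFn Ω z x - 1 - Real.log (supportFn Ω z x))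
      (sphMeasure n) := by
    refine Integrable.sub ?_ hz.integrable
    simp_rw [supportFn_of_eq_closedBall hΩ]
    exact Continuous.integrable_sph (by fun_prop)
  have h3 := (integral_eq_zero_iff_of_nonneg_ae (by
    filter_upwards [hz.ae_pos] with x hx
    exact sub_nonneg.2 (Real.log_le_sub_one_of_pos hx)) hi).1 h2
  -- Equality in log t ≤ t - 1 forces u_z = 1, so ⟨x, z⟩ = 0 almost everywhere; its second moment is
  -- a positive multiple of ‖z‖².
  have h4 : ∀ᵐ x : Sph n ∂(sphMeasure n), ⟪(x : Amb n), z⟫ * ⟪(x : Amb n), z⟫ = 0 := by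
    filter_upwards [h3, hz.ae_pos] with x hx hpos
    have h5 : supportFn Ω z x = 1 := by
      by_contra hne
      have := Real.log_lt_sub_one_of_pos hpos hne
      simp only [Pi.zero_apply] at hx
      linarith
    rw [supportFn_of_eq_closedBall hΩ] at h5
    have h6 : ⟪(x : Amb n), z⟫ = 0 := by linarith
    rw [h6, zero_mul]
  have h5 := integral_sph_inner_mul_inner z z
  rw [integral_congr_ae h4, integral_zero, mul_zero, real_inner_self_eq_norm_sq] at h5
  have h6 := (mul_eq_zero.1 h5.symm).resolve_left hom.ne'
  exact norm_eq_zero.1 (pow_eq_zero_iff two_ne_zero |>.1 h6)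

lemma closedBall_subset_polarBody_zero_of_eq_closedBall : closedBall 0 1 ⊆ polarBody Ω 0 := by
  intro y hy
  refine ⟨y, fun z hz => ?_, add_zero y⟩
  rw [← SetLike.mem_coe, hΩ, mem_closedBall_zero_iff] at hz
  rw [mem_closedBall_zero_iff] at hy
  rw [sub_zero]
  exact (real_inner_le_norm y z).trans (mul_le_one₀ hy (norm_nonneg z) hz)

end Ball

theorem mainTheorem10 (n : ℕ) (hn : 1 ≤ n) (Ω : ConvexBody (Amb n))
    (hsol : IsSoliton (supportFn Ω 0))
    (hvol : volume (Ω : Set (Amb n)) = volume (closedBall (0 : Amb n) 1)) :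
    (IsEntropyPoint Ω 0 ∧ ∀ z : Amb n, IsEntropyPoint Ω z → z = 0) ∧
    volume (closedBall (0 : Amb n) 1) ≤ volume (polarBody Ω 0) ∧
    (IsSantaloPoint Ω 0 → (Ω : Set (Amb n)) = closedBall (0 : Amb n) 1) := by
  have hΩ := eq_closedBall_of_isSoliton hsol hn hvol
  exact ⟨⟨isEntropyPoint_zero_of_eq_closedBall hΩ hn,
    fun z hz => hz.eq_zero_of_eq_closedBall hΩ hn⟩,
    measure_mono (closedBall_subset_polarBody_zero_of_eq_closedBall hΩ), fun _ => hΩ⟩
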